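/- **Conventions.** $\mathbf 1$ is the terminal category, $[1]=(0\to1)$, $n\cdot A$ is the disjoint union of $n$ copies of $A$, and $A^{\lhd}$, $A^{\rhd}$ are obtained from $A$ by freely adjoining an initial, resp. a terminal object. A *prederivator* is a 2-functor $\mathscr D\colon \mathrm{Cat}^{\mathrm{op}}\to\mathrm{CAT}$ (1-cells reversed, 2-cells not); morphisms of prederivators are pseudo-natural transformations, and 2-cells are modifications. For a functor $u\colon A\to B$ write $u^*\colon\mathscr D(B)\to\mathscr D(A)$ for the restriction functor, and $X\mapsto X_a$ for restriction along $a\colon\mathbf 1\to A$. A *derivator* is a prederivator such that (Der1) it sends small coproducts to products up to equivalence; (Der2) $f$ in $\mathscr D(A)$ is an isomorphism iff all $f_a$, $a\in A$, are; (Der3) every $u^*$ has a left adjoint $u_!$ and a right adjoint $u_*$; (Der4) these Kan extensions are pointwise, i.e. for all $u\colon A\to B$ and $b\in B$ the canonical maps $\mathrm{colim}_{(u/b)}\,p^*X\to u_!(X)_b$ and $u_*(X)_b\to\lim_{(b/u)}q^*X$ are isomorphisms, where $p\colon(u/b)\to A$ and $q\colon(b/u)\to A$ are the projections. For a prederivator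 $\mathscr D$ and a small category $E$, let $\mathscr D^E(A)=\mathscr D(E\times A)$; for $x\in E$ and $X\in\mathscr D^E(A)$, $X_x\in\mathscr D(A)$ is the restriction along $A\cong\{x\}\times A\subseteq E\times A$. A functor $u\colon A\to B$ between small categories is a *homotopical epimorphism* if $u^*\colon\mathscr D(B)\to\mathscr D(A)$ is fully faithful for every derivator $\mathscr D$. **Construction.** Let $C$ be a small category and let $y_1,\dots,y_n\in C$ be objects, not necessarily distinct, $n\ge 0$, classified by $y\colon n\cdot\mathbf 1\to C$. Let $Z_n$ be the free category on the quiver with vertices $x_1,\dots,x_n,y_1,\dots,y_n,v$ and one arrow $x_i\to y_i$ and one arrow $x_i\to v$ for each $i$, and let $q\colon Z_n\to(n\cdot\mathbf 1)^{\rhd}$ send $x_i$ and $y_i$ to the $i$-th object, the arrow $x_i\to y_i$ to an identity, and $v$ to the terminal object. Define $D^\pm$, $C^\pm$ and $u^\pm\colon D^\pm\to C^\pm$ by the pushouts in $\mathrm{Cat}$ $$D^+=C\sqcup_{n\cdot\mathbf 1}Z_n,\quad C^+=D^+\sqcup_{Z_n}(n\cdot\mathbf 1)^{\rhd},\qquad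 D^-=C\sqcup_{n\cdot\mathbf 1}(n\cdot[1])^{\lhd},\quad C^-=D^-\sqcup_{(n\cdot[1])^{\lhd}}(n\cdot\mathbf 1)^{\lhd}.$$ Here $n\cdot\mathbf 1\to Z_n$ is $i\mapsto y_i$, and $n\cdot\mathbf 1\to(n\cdot[1])^{\lhd}$ picks the targets of the $n$ arrows. The functor $Z_n\to(n\cdot\mathbf 1)^{\rhd}$ is $q$, and $(n\cdot[1])^{\lhd}\to(n\cdot\mathbf 1)^{\lhd}$ is induced by the collapse $[1]\to\mathbf 1$. Write $x_i\to y_i$ also for the image in $D^+$ of the corresponding arrow of $Z_n$, and in $D^-$ of the $i$-th arrow of $n\cdot[1]$; $u^\pm$ contracts these edges. For a prederivator $\mathscr D$ let $\mathscr D^{D^\pm,\mathrm{ex}}\subseteq\mathscr D^{D^\pm}$ be the full sub-prederivator spanned by those $X\in\mathscr D(D^\pm\times A)$ for which $X_{x_i}\to X_{y_i}$ is an isomorphism in $\mathscr D(A)$ for every $i=1,\dots,n$. **Theorem.** For $u=u^+\colon D^+\to C^+$, and likewise for $u=u^-\colon D^-\to C^-$: 1. $u$ is a homotopical epimorphism.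 2. For every derivator $\mathscr D$, the essential image of $u^*\colon\mathscr D^{C^\pm}\to\mathscr D^{D^\pm}$ is $\mathscr D^{D^\pm,\mathrm{ex}}$: for every small category $A$, an object of $\mathscr D(D^\pm\times A)$ is isomorphic to one of the form $(u\times A)^*Y$ with $Y\in\mathscr D(C^\pm\times A)$ if and only if it lies in $\mathscr D^{D^\pm,\mathrm{ex}}(A)$. 3. The functor $u$ sends the edges $x_i\to y_i$ to isomorphisms, and the resulting morphisms $u^*\colon\mathscr D^{C^\pm}\to\mathscr D^{D^\pm,\mathrm{ex}}$ are pseudo-natural in $\mathscr D$ with respect to arbitrary morphisms of (pre)derivators and are equivalences for every derivator $\mathscr D$. -/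

import Mathlib

universe u v w u₁ v₁ w₁ u₂ v₂ w₂ u₃ v₃ w₃

open CategoryTheory Bicategory Opposite
open scoped CategoryTheory.Pseudofunctor.StrongTrans

noncomputable section

/-! ### Whiskering of pseudofunctors

Pseudofunctors `B ⥤ᵖ C`, strong (i.e. pseudo-natural) transformations and modifications form a
bicategory. We need the pseudofunctor `precomp P : (B ⥤ᵖ C) ⥤ᵖ (A ⥤ᵖ C)` given by precomposition
with `P : A ⥤ᵖ B`, and its functoriality in `P`. -/

namespace PseudoWhisker

variable {A : Type u₁} [Bicategory.{w₁, v₁} A] {B : Type u₂} [Bicategory.{w₂, v₂} B]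
  {C : Type u₃} [Bicategory.{w₃, v₃} C]

theorem whisker_id_swap {a b c d : C} {f : a ⟶ b} {g : b ⟶ d} {h : a ⟶ c} {k : c ⟶ d}
    (x : f ≫ g ⟶ h ≫ k) : f ◁ 𝟙 g ≫ x = x ≫ 𝟙 h ▷ k := by simp

theorem whisker_id_swap' {a b c d : C} {f : a ⟶ b} {g : b ⟶ d} {h : a ⟶ c} {k : c ⟶ d}
    {x y : f ≫ g ⟶ h ≫ k} (e : x = y) : x ≫ h ◁ 𝟙 k = 𝟙 f ▷ g ≫ y := by simp [e]

/-- Composition of pseudofunctors. -/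
abbrev comp (P : A ⥤ᵖ B) (G : B ⥤ᵖ C) : A ⥤ᵖ C where
  obj a := G.obj (P.obj a)
  map f := G.map (P.map f)
  map₂ α := G.map₂ (P.map₂ α)
  mapId a := G.map₂Iso (P.mapId a) ≪≫ G.mapId (P.obj a)
  mapComp f g := (G.map₂Iso (P.mapComp f g)) ≪≫ G.mapComp (P.map f) (P.map g)

/-- The whiskering `P ≫ η` of a pseudo-natural transformation `η` with a pseudofunctor `P`. -/
abbrev left (P : A ⥤ᵖ B) {G H : B ⥤ᵖ C} (η : G ⟶ H) : comp P G ⟶ comp P H where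
  app a := η.app (P.obj a)
  naturality f := η.naturality (P.map f)
  naturality_id a := by
    simp [← η.naturality_naturality_assoc]
  naturality_comp f g := by
    simp [← η.naturality_naturality_assoc]

/-- The whiskering of a modification with a pseudofunctor. -/
abbrev left₂ (P : A ⥤ᵖ B) {G H : B ⥤ᵖ C} {η θ : G ⟶ H} (Γ : η ⟶ θ) : left P η ⟶ left P θ where
  as := { app a := Γ.as.app (P.obj a)
          naturality f := Γ.as.naturality (P.map f) }

/-- An invertible modification from invertible components. -/
abbrev isoMk {G H : A ⥤ᵖ C} {η θ : G ⟶ H} (app : ∀ a, η.app a ≅ θ.app a)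
    (naturality : ∀ {a b : A} (f : a ⟶ b),
      G.map f ◁ (app b).hom ≫ (θ.naturality f).hom =
        (η.naturality f).hom ≫ (app a).hom ▷ H.map f) : η ≅ θ where
  hom := ⟨⟨fun a => (app a).hom, naturality⟩⟩
  inv := ⟨⟨fun a => (app a).inv, fun {a b} f => by
    simpa using _ ◁ (app b).inv ≫= (naturality f).symm =≫ (app a).inv ▷ _⟩⟩

/-- Precomposition with `P`, as a pseudofunctor between bicategories of pseudofunctors. -/
abbrev precomp (P : A ⥤ᵖ B) : (B ⥤ᵖ C) ⥤ᵖ (A ⥤ᵖ C) where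
  obj G := comp P G
  map η := left P η
  map₂ Γ := left₂ P Γ
  mapId G := isoMk (fun a => Iso.refl (𝟙 (G.obj (P.obj a)))) (fun _ => whisker_id_swap _)
  mapComp η θ := isoMk (fun a => Iso.refl (η.app (P.obj a) ≫ θ.app (P.obj a))) (fun _ => whisker_id_swap _)
  map₂_whisker_left f _ _ η := by ext a; simp
  map₂_whisker_right η f := by ext a; simp
  map₂_left_unitor f := by
    ext a
    exact (by simp : (λ_ (f.app (P.obj a))).hom =
      𝟙 _ ≫ 𝟙 (𝟙 _) ▷ f.app (P.obj a) ≫ (λ_ (f.app (P.obj a))).hom)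
  map₂_right_unitor f := by
    ext a
    exact (by simp : (ρ_ (f.app (P.obj a))).hom =
      𝟙 _ ≫ f.app (P.obj a) ◁ 𝟙 (𝟙 _) ≫ (ρ_ (f.app (P.obj a))).hom)
  map₂_associator f g h := by ext a; simp

/-- The whiskering of a pseudo-natural transformation `α : P ⟶ Q` with a pseudofunctor `G`. -/
abbrev right {P Q : A ⥤ᵖ B} (α : P ⟶ Q) (G : B ⥤ᵖ C) : comp P G ⟶ comp Q G where
  app a := G.map (α.app a)
  naturality f := (G.mapComp _ _).symm ≪≫ G.map₂Iso (α.naturality f) ≪≫ G.mapComp _ _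
  naturality_naturality {a b f g} β := by
    have h := congrArg G.map₂ (α.naturality_naturality β)
    simp only [G.map₂_comp, G.map₂_whisker_left, G.map₂_whisker_right] at h
    simp only [Category.assoc] at h
    have h' := (G.mapComp _ _).inv ≫= h =≫ (G.mapComp _ _).hom
    simpa using h'
  naturality_id a := by
    have h := congrArg G.map₂ (α.naturality_id a)
    simp only [G.map₂_comp, G.map₂_whisker_left, G.map₂_whisker_right, Category.assoc] at h
    have h' := (G.mapComp _ _).inv ≫= h =≫ (G.mapComp _ _).hom ≫ G.map (α.app a) ◁ (G.mapId _).hom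
    simp [G.map₂_left_unitor] at h' ⊢
    have e := G.map₂_right_unitor (α.app a)
    have e' : G.map₂ (ρ_ (α.app a)).inv ≫ (G.mapComp (α.app a) (𝟙 (Q.obj a))).hom ≫
        G.map (α.app a) ◁ (G.mapId (Q.obj a)).hom = (ρ_ (G.map (α.app a))).inv := by
      rw [← cancel_mono (ρ_ (G.map (α.app a))).hom, Category.assoc, Category.assoc, ← e,
        ← G.map₂_comp, Iso.inv_hom_id, Iso.inv_hom_id, G.map₂_id]
    rw [h', e']
  naturality_comp f g := by
    have h := congrArg G.map₂ (α.naturality_comp f g)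
    simp only [G.map₂_comp, G.map₂_whisker_left, G.map₂_whisker_right, Category.assoc] at h
    have h' := (G.mapComp _ _).inv ≫= h =≫ (G.mapComp _ _).hom
    have e : G.map₂ (α_ (P.map f) (α.app _) (Q.map g)).inv = inv (G.map₂ (α_ _ _ _).hom) := by
      rw [← G.map₂_inv, IsIso.Iso.inv_hom]
    rw [e] at h'
    simp [G.map₂_associator] at h' ⊢
    simp [reassoc_of% h']

/-- A pseudo-natural transformation `α : P ⟶ Q` induces a pseudo-natural transformation
`precomp P ⟶ precomp Q`; its component at `G` is `G α`, and its coherence isomorphism at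
`η : G ⟶ H` is given by the coherence isomorphisms of `η` at the components of `α`. -/
abbrev precompTrans {P Q : A ⥤ᵖ B} (α : P ⟶ Q) :
    (precomp P : (B ⥤ᵖ C) ⥤ᵖ (A ⥤ᵖ C)) ⟶ precomp Q where
  app G := right α G
  naturality {G H} η := isoMk (fun a => (η.naturality (α.app a)).symm)
    (fun {a b} f => by
      have h := η.naturality_naturality (α.naturality f).hom
      simp only [Pseudofunctor.StrongTrans.naturality_comp_hom] at h
      have h' := (G.map (P.map f) ◁ (η.naturality (α.app b)).inv ≫ (α_ _ _ _).inv ≫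
        (G.mapComp (P.map f) (α.app b)).inv ▷ η.app (Q.obj b)) ≫= h =≫
        (η.app (P.obj a) ◁ (H.mapComp (α.app a) (Q.map f)).hom ≫ (α_ _ _ _).inv ≫
          (η.naturality (α.app a)).inv ▷ H.map (Q.map f))
      change G.map (P.map f) ◁ (η.naturality (α.app b)).inv ≫ (α_ _ _ _).inv ≫
          ((G.mapComp (P.map f) (α.app b)).inv ≫ G.map₂ (α.naturality f).hom ≫
            (G.mapComp (α.app a) (Q.map f)).hom) ▷ η.app (Q.obj b) ≫ (α_ _ _ _).hom ≫
          G.map (α.app a) ◁ (η.naturality (Q.map f)).hom ≫ (α_ _ _ _).inv =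
        ((α_ _ _ _).inv ≫ (η.naturality (P.map f)).hom ▷ H.map (α.app b) ≫ (α_ _ _ _).hom ≫
          η.app (P.obj a) ◁ ((H.mapComp (P.map f) (α.app b)).inv ≫ H.map₂ (α.naturality f).hom ≫
            (H.mapComp (α.app a) (Q.map f)).hom) ≫ (α_ _ _ _).inv) ≫
          (η.naturality (α.app a)).inv ▷ H.map (Q.map f)
      simp at h' ⊢
      exact h')
  naturality_naturality {G H η θ} Γ := by
    ext a
    have h := Γ.as.naturality (α.app a)
    have h' := (η.naturality _).inv ≫= h =≫ (θ.naturality _).inv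
    simp only [Category.assoc, Iso.hom_inv_id, Iso.inv_hom_id_assoc, Category.comp_id] at h'
    exact h'.symm
  naturality_id a := by
    ext c
    exact (by simp : ((λ_ (a.map (α.app c))).hom ≫ (ρ_ (a.map (α.app c))).inv) ≫ a.map (α.app c) ◁ 𝟙 (𝟙 _) =
       𝟙 (𝟙 _) ▷ a.map (α.app c) ≫ (λ_ (a.map (α.app c))).hom ≫ (ρ_ (a.map (α.app c))).inv)
  naturality_comp {G₁ G₂ G₃} f g := by
    ext a
    have h : ((f ≫ g).naturality (α.app a)).inv =
        ((((α_ (f.app _) (g.app _) (G₃.map (α.app a))).hom ≫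
          f.app _ ◁ (g.naturality (α.app a)).inv) ≫ (α_ _ _ _).inv) ≫
          (f.naturality (α.app a)).inv ▷ g.app _) ≫ (α_ _ _ _).hom :=
      Pseudofunctor.StrongTrans.categoryStruct_comp_naturality_inv f g (α.app a)
    simp only [Category.assoc] at h
    exact whisker_id_swap' h


/-! #### Full sub-pseudofunctors -/

section Sub

variable {B : Type u₂} [Bicategory.{w₂, v₂} B]

/-- A pseudo-natural transformation whose components take values in a property `P` of objects
factors through the full sub-pseudofunctor defined by `P`. -/
abbrev subLift {F D : B ⥤ᵖ Cat.{v, w}} (P : D.ObjectProperty) [P.IsClosedUnderMapObj]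
    (η : F ⟶ D) (h : ∀ b X, P.prop b ((η.app b).toFunctor.obj X)) : F ⟶ P.fullsubcategory where
  app b := Cat.Hom.ofFunctor ((P.prop b).lift (η.app b).toFunctor (h b))
  naturality {b c} f := Cat.Hom.isoMk (NatIso.ofComponents
    (fun X => (P.prop c).isoMk ((Cat.Hom.toNatIso (η.naturality f)).app X))
    (fun {X Y} g => by
      apply ObjectProperty.hom_ext
      exact (Cat.Hom.toNatIso (η.naturality f)).hom.naturality g))
  naturality_naturality {b c f g} α := by
    ext X
    apply ObjectProperty.hom_ext
    have h := congrArg (fun t => t.toNatTrans.app X) (η.naturality_naturality α)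
    exact h
  naturality_id b := by
    ext X
    apply ObjectProperty.hom_ext
    have h := congrArg (fun t => t.toNatTrans.app X) (η.naturality_id b)
    exact h
  naturality_comp f g := by
    ext X
    apply ObjectProperty.hom_ext
    have h := congrArg (fun t => t.toNatTrans.app X) (η.naturality_comp f g)
    exact h

/-- A pseudo-natural transformation sending `Q` to `P` restricts to the full sub-pseudofunctors. -/
abbrev subMap {F D : B ⥤ᵖ Cat.{v, w}} (Q : F.ObjectProperty) [Q.IsClosedUnderMapObj]
    (P : D.ObjectProperty) [P.IsClosedUnderMapObj]
    (η : F ⟶ D) (h : ∀ b X, Q.prop b X → P.prop b ((η.app b).toFunctor.obj X)) :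
    Q.fullsubcategory ⟶ P.fullsubcategory where
  app b := Cat.Hom.ofFunctor
    ((P.prop b).lift ((Q.prop b).ι ⋙ (η.app b).toFunctor) (fun X => h b X.obj X.property))
  naturality {b c} f := Cat.Hom.isoMk (NatIso.ofComponents
    (fun X => (P.prop c).isoMk ((Cat.Hom.toNatIso (η.naturality f)).app X.obj))
    (fun {X Y} g => by
      apply ObjectProperty.hom_ext
      exact (Cat.Hom.toNatIso (η.naturality f)).hom.naturality g.hom))
  naturality_naturality {b c f g} α := by
    ext X
    apply ObjectProperty.hom_ext
    have h := congrArg (fun t => t.toNatTrans.app X.obj) (η.naturality_naturality α)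
    exact h
  naturality_id b := by
    ext X
    apply ObjectProperty.hom_ext
    have h := congrArg (fun t => t.toNatTrans.app X.obj) (η.naturality_id b)
    exact h
  naturality_comp f g := by
    ext X
    apply ObjectProperty.hom_ext
    have h := congrArg (fun t => t.toNatTrans.app X.obj) (η.naturality_comp f g)
    exact h

/-- Invertible modifications between transformations to a full sub-pseudofunctor, objectwise. -/
abbrev subIso {F D : B ⥤ᵖ Cat.{v, w}} {P : D.ObjectProperty} [P.IsClosedUnderMapObj]
    {η θ : F ⟶ P.fullsubcategory}
    (γ : ∀ b (X : F.obj b), ((η.app b).toFunctor.obj X).obj ≅ ((θ.app b).toFunctor.obj X).obj)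
    (h₁ : ∀ b {X Y : F.obj b} (g : X ⟶ Y),
      ((η.app b).toFunctor.map g).hom ≫ (γ b Y).hom =
        (γ b X).hom ≫ ((θ.app b).toFunctor.map g).hom)
    (h₂ : ∀ {b c} (f : b ⟶ c) (X : F.obj b),
      (γ c ((F.map f).toFunctor.obj X)).hom ≫ ((θ.naturality f).hom.toNatTrans.app X).hom =
        ((η.naturality f).hom.toNatTrans.app X).hom ≫ (D.map f).toFunctor.map (γ b X).hom) :
    η ≅ θ :=
  isoMk (fun b => Cat.Hom.isoMk (NatIso.ofComponents (fun X => (P.prop b).isoMk (γ b X))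
    (fun g => ObjectProperty.hom_ext _ (h₁ b g))))
    (fun f => by
      ext X
      apply ObjectProperty.hom_ext
      exact h₂ f X)

/-- The restriction of a modification to full sub-pseudofunctors. -/
abbrev subMap₂ {F D : B ⥤ᵖ Cat.{v, w}} {Q : F.ObjectProperty} [Q.IsClosedUnderMapObj]
    {P : D.ObjectProperty} [P.IsClosedUnderMapObj]
    {η θ : F ⟶ D} (hη : ∀ b X, Q.prop b X → P.prop b ((η.app b).toFunctor.obj X))
    (hθ : ∀ b X, Q.prop b X → P.prop b ((θ.app b).toFunctor.obj X)) (Γ : η ⟶ θ) :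
    subMap Q P η hη ⟶ subMap Q P θ hθ where
  as := { app b := Cat.Hom₂.ofNatTrans
            { app X := ObjectProperty.homMk ((Γ.as.app b).toNatTrans.app X.obj)
              naturality X Y f := by
                apply ObjectProperty.hom_ext
                exact (Γ.as.app b).toNatTrans.naturality f.hom }
          naturality {b c} f := by
            ext X
            apply ObjectProperty.hom_ext
            have h := congrArg (fun t => t.toNatTrans.app X.obj) (Γ.as.naturality f)
            exact h }

variable {K : Type u₁} [Bicategory.{w₁, v₁} K]

theorem modIso_naturality_app {F D : B ⥤ᵖ Cat.{v, w}} {η θ : F ⟶ D} (Γ : η ⟶ θ) {b c : B}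
    (f : b ⟶ c) (X : F.obj b) :
    (Γ.as.app c).toNatTrans.app ((F.map f).toFunctor.obj X) ≫
      (θ.naturality f).hom.toNatTrans.app X =
    (η.naturality f).hom.toNatTrans.app X ≫
      (D.map f).toFunctor.map ((Γ.as.app b).toNatTrans.app X) :=
  congrArg (fun t => t.toNatTrans.app X) (Γ.as.naturality f)

/-- The components of an invertible modification are isomorphisms. -/
abbrev modApp {F D : B ⥤ᵖ Cat.{v, w}} {η θ : F ⟶ D} (Γ : η ≅ θ) (b : B) (X : F.obj b) :
    (η.app b).toFunctor.obj X ≅ (θ.app b).toFunctor.obj X where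
  hom := (Γ.hom.as.app b).toNatTrans.app X
  inv := (Γ.inv.as.app b).toNatTrans.app X
  hom_inv_id := congrArg (fun t => (t.as.app b).toNatTrans.app X) Γ.hom_inv_id
  inv_hom_id := congrArg (fun t => (t.as.app b).toNatTrans.app X) Γ.inv_hom_id

/-- Let `Ψ` be a pseudofunctor with values in pseudofunctors `B ⥤ᵖ Cat`. If the properties `P k` of
objects of `Ψ k` are preserved by the transformations `Ψ f`, then `k ↦ P k ⊆ Ψ k` is a pseudofunctor. -/
abbrev sub (Ψ : K ⥤ᵖ (B ⥤ᵖ Cat.{v, w})) (P : ∀ k, (Ψ.obj k).ObjectProperty)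
    [∀ k, (P k).IsClosedUnderMapObj]
    (hP : ∀ {k l : K} (f : k ⟶ l) b X, (P k).prop b X →
      (P l).prop b (((Ψ.map f).app b).toFunctor.obj X)) : K ⥤ᵖ (B ⥤ᵖ Cat.{v, w}) where
  obj k := (P k).fullsubcategory
  map {k l} f := subMap (P k) (P l) (Ψ.map f) (hP f)
  map₂ {k l f g} α := subMap₂ (hP f) (hP g) (Ψ.map₂ α)
  mapId k := subIso (fun b X => modApp (Ψ.mapId k) b X.obj)
    (fun b {X Y} g => ((Ψ.mapId k).hom.as.app b).toNatTrans.naturality g.hom)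
    (fun f X => modIso_naturality_app (Ψ.mapId k).hom f X.obj)
  mapComp {k l m} f g := subIso (fun b X => modApp (Ψ.mapComp f g) b X.obj)
    (fun b {X Y} e => ((Ψ.mapComp f g).hom.as.app b).toNatTrans.naturality e.hom)
    (fun e X => modIso_naturality_app (Ψ.mapComp f g).hom e X.obj)
  map₂_id f := by
    ext b X
    apply ObjectProperty.hom_ext
    exact congrArg (fun t => (t.as.app b).toNatTrans.app X.obj) (Ψ.map₂_id f)
  map₂_comp f g := by
    ext b X
    apply ObjectProperty.hom_ext
    exact congrArg (fun t => (t.as.app b).toNatTrans.app X.obj) (Ψ.map₂_comp f g)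
  map₂_whisker_left f _ _ η := by
    ext b X
    apply ObjectProperty.hom_ext
    exact congrArg (fun t => (t.as.app b).toNatTrans.app X.obj) (Ψ.map₂_whisker_left f η)
  map₂_whisker_right η f := by
    ext b X
    apply ObjectProperty.hom_ext
    exact congrArg (fun t => (t.as.app b).toNatTrans.app X.obj) (Ψ.map₂_whisker_right η f)
  map₂_left_unitor f := by
    ext b X
    apply ObjectProperty.hom_ext
    exact congrArg (fun t => (t.as.app b).toNatTrans.app X.obj) (Ψ.map₂_left_unitor f)
  map₂_right_unitor f := by
    ext b X
    apply ObjectProperty.hom_ext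
    exact congrArg (fun t => (t.as.app b).toNatTrans.app X.obj) (Ψ.map₂_right_unitor f)
  map₂_associator f g h := by
    ext b X
    apply ObjectProperty.hom_ext
    exact congrArg (fun t => (t.as.app b).toNatTrans.app X.obj) (Ψ.map₂_associator f g h)

/-- A pseudo-natural transformation `τ : Θ ⟶ Ψ` whose components take values in `P k ⊆ Ψ k`
factors through `sub Ψ P`. -/
abbrev subLiftTrans {Θ Ψ : K ⥤ᵖ (B ⥤ᵖ Cat.{v, w})} (P : ∀ k, (Ψ.obj k).ObjectProperty)
    [∀ k, (P k).IsClosedUnderMapObj]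
    (hP : ∀ {k l : K} (f : k ⟶ l) b X, (P k).prop b X →
      (P l).prop b (((Ψ.map f).app b).toFunctor.obj X))
    (τ : Θ ⟶ Ψ) (hτ : ∀ k b X, (P k).prop b (((τ.app k).app b).toFunctor.obj X)) :
    Θ ⟶ sub Ψ P hP where
  app k := subLift (P k) (τ.app k) (hτ k)
  naturality {k l} f := subIso (fun b X => modApp (τ.naturality f) b X)
    (fun b {X Y} g => ((τ.naturality f).hom.as.app b).toNatTrans.naturality g)
    (fun e X => by exact modIso_naturality_app (τ.naturality f).hom e X)
  naturality_naturality {b c f g} α := by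
    ext b X
    apply ObjectProperty.hom_ext
    exact congrArg (fun t => (t.as.app b).toNatTrans.app X) (τ.naturality_naturality α)
  naturality_id k := by
    ext b X
    apply ObjectProperty.hom_ext
    exact congrArg (fun t => (t.as.app b).toNatTrans.app X) (τ.naturality_id k)
  naturality_comp f g := by
    ext b X
    apply ObjectProperty.hom_ext
    exact congrArg (fun t => (t.as.app b).toNatTrans.app X) (τ.naturality_comp f g)

end Sub
end PseudoWhisker

/-! ### Prederivators and derivators -/

/-- Prederivators: contravariant 2-functors (possibly only pseudofunctors) from small categories to
categories. Both 1-cells are reversed, 2-cells are not. The 1-cells of this bicategory are the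
pseudo-natural transformations and its 2-cells are the modifications. -/
abbrev PDer : Type (max (u + 1) (v + 1) (w + 1)) := Pseudofunctor (Cat.{u, u})ᵒᵖ Cat.{v, w}

namespace PDer

variable (D : PDer.{u, v, w})

/-- The category `D(A)` of coherent diagrams of shape `A`. -/
abbrev Diag (A : Type u) [SmallCategory A] : Type w := D.obj (op (Cat.of A))

/-- The restriction functor `f^* : D(B) ⥤ D(A)` along `f : A ⥤ B`. -/
abbrev res {A B : Type u} [SmallCategory A] [SmallCategory B] (f : A ⥤ B) : D.Diag B ⥤ D.Diag A :=
  (D.map f.toCatHom.op).toFunctor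

/-- The natural transformation `f^* ⟶ g^*` induced by `f ⟶ g`. -/
abbrev resTrans {A B : Type u} [SmallCategory A] [SmallCategory B] {f g : A ⥤ B} (α : f ⟶ g) :
    D.res f ⟶ D.res g :=
  (D.map₂ (Bicategory.Opposite.op2 α.toCatHom₂)).toNatTrans

/-- The structure isomorphism `(g f)^* ≅ f^* g^*`. -/
abbrev resComp {A B C : Type u} [SmallCategory A] [SmallCategory B] [SmallCategory C]
    (f : A ⥤ B) (g : B ⥤ C) : D.res (f ⋙ g) ≅ D.res g ⋙ D.res f :=
  Cat.Hom.toNatIso (D.mapComp g.toCatHom.op f.toCatHom.op)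

/-- The evaluation functor `X ↦ X_a` from `D(A)` to the underlying category `D(1)`. -/
abbrev eval {A : Type u} [SmallCategory A] (a : A) : D.Diag A ⥤ D.Diag (Discrete PUnit.{u + 1}) :=
  D.res (Functor.fromPUnit.{u} a)

/-- A square of small categories with a 2-cell `α : f p ⟶ g q` induces a square of restriction
functors with a 2-cell `p^* f^* ⟶ q^* g^*`. -/
abbrev square {J A K B : Type u} [SmallCategory J] [SmallCategory A] [SmallCategory K]
    [SmallCategory B] {p : J ⥤ A} {f : A ⥤ B} {q : J ⥤ K} {g : K ⥤ B}
    (α : p ⋙ f ⟶ q ⋙ g) : TwoSquare (D.res f) (D.res g) (D.res p) (D.res q) :=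
  TwoSquare.mk _ _ _ _ ((D.resComp p f).inv ≫ D.resTrans α ≫ (D.resComp q g).hom)

/-- The 2-cell `f p ⟶ b π` of the slice square of `(f/b)`, with component `h` at `(a, h)`. -/
abbrev overTrans {A B : Type u} [SmallCategory A] [SmallCategory B] (f : A ⥤ B) (b : B) :
    CostructuredArrow.proj f b ⋙ f ⟶
      (Functor.star.{u} (CostructuredArrow f b)) ⋙ Functor.fromPUnit.{u} b where
  app x := x.hom
  naturality x _ g := (CostructuredArrow.w g).trans (Category.comp_id x.hom).symm

/-- The 2-cell `b π ⟶ f q` of the slice square of `(b/f)`, with component `h` at `(a, h)`. -/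
abbrev underTrans {A B : Type u} [SmallCategory A] [SmallCategory B] (f : A ⥤ B) (b : B) :
    (Functor.star.{u} (StructuredArrow b f)) ⋙ Functor.fromPUnit.{u} b ⟶
      StructuredArrow.proj b f ⋙ f where
  app x := x.hom
  naturality _ y g := (Category.id_comp y.hom).trans (StructuredArrow.w g).symm

/-- The axioms (Der1)-(Der4) of a derivator. -/
structure IsDerivator : Prop where
  /-- Coproducts are sent to products: `D(∐ A_i) ⥤ ∏ D(A_i)` is an equivalence. -/
  der1 : ∀ (ι : Type u) (A : ι → Type u) [∀ i, SmallCategory (A i)],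
    (Functor.pi' (fun i => D.res (Sigma.incl (C := A) i))).IsEquivalence
  /-- Isomorphisms are detected pointwise. -/
  der2 : ∀ {A : Type u} [SmallCategory A] {X Y : D.Diag A} (f : X ⟶ Y),
    IsIso f ↔ ∀ a : A, IsIso ((D.eval a).map f)
  /-- Left Kan extensions exist. -/
  der3_left : ∀ {A B : Type u} [SmallCategory A] [SmallCategory B] (f : A ⥤ B),
    (D.res f).IsRightAdjoint
  /-- Right Kan extensions exist. -/
  der3_right : ∀ {A B : Type u} [SmallCategory A] [SmallCategory B] (f : A ⥤ B),
    (D.res f).IsLeftAdjoint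
  /-- Left Kan extensions are pointwise: the mate `π_! p^* ⟶ b^* f_!` is invertible. -/
  der4_left : ∀ {A B : Type u} [SmallCategory A] [SmallCategory B] (f : A ⥤ B) (b : B)
    (lan : D.Diag A ⥤ D.Diag B) (adj₁ : lan ⊣ D.res f)
    (colim : D.Diag (CostructuredArrow f b) ⥤ D.Diag (Discrete PUnit.{u + 1}))
    (adj₂ : colim ⊣ D.res (Functor.star.{u} (CostructuredArrow f b))),
    IsIso ((mateEquiv adj₁ adj₂).symm (D.square (overTrans f b))).natTrans
  /-- Right Kan extensions are pointwise: the mate `b^* f_* ⟶ π_* q^*` is invertible. -/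
  der4_right : ∀ {A B : Type u} [SmallCategory A] [SmallCategory B] (f : A ⥤ B) (b : B)
    (ran : D.Diag A ⥤ D.Diag B) (adj₁ : D.res f ⊣ ran)
    (lim : D.Diag (StructuredArrow b f) ⥤ D.Diag (Discrete PUnit.{u + 1}))
    (adj₂ : D.res (Functor.star.{u} (StructuredArrow b f)) ⊣ lim),
    IsIso (mateEquiv adj₁ adj₂ (D.square (underTrans f b))).natTrans

end PDer

/-- A functor `f : A ⥤ B` is a homotopical epimorphism if `f^* : D(B) ⥤ D(A)` is fully faithful
for every derivator `D`. -/
def IsHomotopicalEpi {A B : Type u} [SmallCategory A] [SmallCategory B] (f : A ⥤ B) : Prop :=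
  ∀ D : PDer.{u, v, w}, D.IsDerivator → (D.res f).Full ∧ (D.res f).Faithful

/-! ### Shifts and the exactness condition -/

/-- A natural isomorphism as an invertible 2-cell of the opposite bicategory. -/
abbrev opIso {A B : Type u} [SmallCategory A] [SmallCategory B] {F G : A ⥤ B} (e : F ≅ G) :
    F.toCatHom.op ≅ G.toCatHom.op where
  hom := Bicategory.Opposite.op2 e.hom.toCatHom₂
  inv := Bicategory.Opposite.op2 e.inv.toCatHom₂
  hom_inv_id := congrArg (fun t => Bicategory.Opposite.op2 (NatTrans.toCatHom₂ t)) e.hom_inv_id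
  inv_hom_id := congrArg (fun t => Bicategory.Opposite.op2 (NatTrans.toCatHom₂ t)) e.inv_hom_id

theorem op_hom₂_ext {A B : (Cat.{u, u})ᵒᵖ} {f g : A ⟶ B} {α β : f ⟶ g}
    (h : ∀ x, α.unop2.toNatTrans.app x = β.unop2.toNatTrans.app x) : α = β := by
  obtain ⟨α⟩ := α
  obtain ⟨β⟩ := β
  congr 1
  ext x
  exact h x

/-- The 2-functor `A ↦ E × A` on the opposite of the bicategory of small categories. -/
abbrev prodLeft (E : Type u) [SmallCategory E] : (Cat.{u, u})ᵒᵖ ⥤ᵖ (Cat.{u, u})ᵒᵖ where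
  obj A := op (Cat.of (E × A.unop))
  map f := ((𝟭 E).prod f.unop.toFunctor).toCatHom.op
  map₂ α := Bicategory.Opposite.op2 (NatTrans.toCatHom₂
    (NatTrans.prod (𝟙 (𝟭 E)) α.unop2.toNatTrans))
  mapId A := opIso (NatIso.ofComponents (fun X => Iso.refl X))
  mapComp f g := opIso (NatIso.ofComponents (fun X => Iso.refl _))
  map₂_id f := op_hom₂_ext fun x => rfl
  map₂_comp f g := op_hom₂_ext fun x => Prod.ext
    (by exact (by simp : 𝟙 x.1 = 𝟙 x.1 ≫ 𝟙 x.1)) rfl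
  map₂_whisker_left f _ _ α := op_hom₂_ext fun x => Prod.ext
    (by exact (by simp : 𝟙 x.1 = 𝟙 x.1 ≫ 𝟙 x.1 ≫ 𝟙 x.1))
    (by exact (by simp : f.unop.toFunctor.map (α.unop2.toNatTrans.app x.2) =
      𝟙 _ ≫ f.unop.toFunctor.map (α.unop2.toNatTrans.app x.2) ≫ 𝟙 _))
  map₂_whisker_right α f := op_hom₂_ext fun x => Prod.ext
    (by exact (by simp : 𝟙 x.1 = 𝟙 x.1 ≫ 𝟙 x.1 ≫ 𝟙 x.1))
    (by exact (by simp : α.unop2.toNatTrans.app (f.unop.toFunctor.obj x.2) =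
      𝟙 _ ≫ α.unop2.toNatTrans.app (f.unop.toFunctor.obj x.2) ≫ 𝟙 _))
  map₂_left_unitor f := op_hom₂_ext fun x => Prod.ext
    (by exact (by simp : 𝟙 x.1 = 𝟙 x.1 ≫ 𝟙 x.1 ≫ 𝟙 x.1))
    (by exact (by simp : 𝟙 (f.unop.toFunctor.obj x.2) = 𝟙 _ ≫ 𝟙 _ ≫ 𝟙 _))
  map₂_right_unitor f := op_hom₂_ext fun x => Prod.ext
    (by exact (by simp : 𝟙 x.1 = 𝟙 x.1 ≫ 𝟙 x.1 ≫ 𝟙 x.1))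
    (by exact (by simp : 𝟙 (f.unop.toFunctor.obj x.2) =
      𝟙 _ ≫ f.unop.toFunctor.map (𝟙 x.2) ≫ 𝟙 _))
  map₂_associator f g h := op_hom₂_ext fun x => Prod.ext
    (by exact (by simp : 𝟙 x.1 = 𝟙 x.1 ≫ 𝟙 x.1 ≫ 𝟙 x.1 ≫ 𝟙 x.1 ≫ 𝟙 x.1))
    (by exact (by simp :
      𝟙 (f.unop.toFunctor.obj (g.unop.toFunctor.obj (h.unop.toFunctor.obj x.2))) =
      𝟙 _ ≫ 𝟙 _ ≫ 𝟙 _ ≫ f.unop.toFunctor.map (𝟙 _) ≫ 𝟙 _))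

/-- The transformation with components `k × A : E × A ⥤ F × A`, for a functor `k : E ⥤ F`. -/
abbrev prodLeftMap {E F : Type u} [SmallCategory E] [SmallCategory F] (k : E ⥤ F) :
    prodLeft F ⟶ prodLeft E where
  app A := (k.prod (𝟭 A.unop)).toCatHom.op
  naturality f := opIso (NatIso.ofComponents (fun X => Iso.refl _) (fun g => Prod.ext
    (by exact (by simp : k.map g.1 ≫ 𝟙 _ = 𝟙 _ ≫ k.map g.1))
    (by exact (by simp : f.unop.toFunctor.map g.2 ≫ 𝟙 _ = 𝟙 _ ≫ f.unop.toFunctor.map g.2))))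
  naturality_naturality α := op_hom₂_ext fun x => Prod.ext
    (by exact (by simp : 𝟙 (k.obj x.1) ≫ 𝟙 (k.obj x.1) = 𝟙 (k.obj x.1) ≫ k.map (𝟙 x.1)))
    (by exact (by simp : α.unop2.toNatTrans.app x.2 ≫ 𝟙 _ = 𝟙 _ ≫ α.unop2.toNatTrans.app x.2))
  naturality_id A := op_hom₂_ext fun x => Prod.ext
    (by exact (by simp : 𝟙 (k.obj x.1) ≫ k.map (𝟙 x.1) = 𝟙 _ ≫ 𝟙 _ ≫ 𝟙 _))
    (by exact (by simp : 𝟙 x.2 ≫ 𝟙 x.2 = 𝟙 x.2 ≫ 𝟙 _ ≫ 𝟙 _))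
  naturality_comp f g := op_hom₂_ext fun x => Prod.ext
    (by exact (by simp : 𝟙 (k.obj x.1) ≫ k.map (𝟙 x.1) =
      𝟙 _ ≫ 𝟙 _ ≫ 𝟙 _ ≫ 𝟙 _ ≫ 𝟙 _ ≫ 𝟙 _))
    (by exact (by simp : 𝟙 (f.unop.toFunctor.obj (g.unop.toFunctor.obj x.2)) ≫ 𝟙 _ =
      𝟙 _ ≫ 𝟙 _ ≫ f.unop.toFunctor.map (𝟙 _) ≫ 𝟙 _ ≫ 𝟙 _ ≫ 𝟙 _))

/-- The functor `A ⥤ E × A`, `a ↦ (x, a)`; restriction along it is `X ↦ X_x`, from `D(E × A)`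
to `D(A)`. -/
abbrev sect {E : Type u} [SmallCategory E] (x : E) (A : (Cat.{u, u})ᵒᵖ) :
    (prodLeft E).obj A ⟶ A :=
  (Prod.sectR x A.unop).toCatHom.op

/-- For `f : x ⟶ y` in `E`, the transformation inducing the morphism `X_x ⟶ X_y` in `D(A)`. -/
abbrev sectMap {E : Type u} [SmallCategory E] {x y : E} (f : x ⟶ y) (A : (Cat.{u, u})ᵒᵖ) :
    sect x A ⟶ sect y A :=
  Bicategory.Opposite.op2 (NatTrans.toCatHom₂
    { app a := Prod.mkHom f (𝟙 a)
      naturality a b g := Prod.ext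
        (by exact (by simp : 𝟙 x ≫ f = f ≫ 𝟙 y)) (by exact (by simp : g ≫ 𝟙 b = 𝟙 a ≫ g)) })

/-- The property of `X ∈ D^E(A) = D(E × A)` that `X_x ⟶ X_y` is an isomorphism in `D(A)` for every
`f : x ⟶ y` in the class `W` of morphisms of `E`. -/
abbrev invertedProp (D : PDer.{u, v, w}) {E : Type u} [SmallCategory E] (W : MorphismProperty E) :
    (((PseudoWhisker.precomp (prodLeft E)).obj D : PDer.{u, v, w})).ObjectProperty where
  prop A X := ∀ ⦃x y : E⦄ (f : x ⟶ y), W f → IsIso ((D.map₂ (sectMap f A)).toNatTrans.app X)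

theorem isIso_map₂_whiskerLeft (D : PDer.{u, v, w}) {a b c : (Cat.{u, u})ᵒᵖ} (f : a ⟶ b)
    {g h : b ⟶ c} (α : g ⟶ h) (X : D.obj a) :
    IsIso ((D.map₂ (f ◁ α)).toNatTrans.app X) ↔
      IsIso ((D.map₂ α).toNatTrans.app ((D.map f).toFunctor.obj X)) := by
  have e : (D.map₂ (f ◁ α)).toNatTrans.app X =
      (Cat.Hom.toNatIso (D.mapComp f g)).hom.app X ≫
        (D.map₂ α).toNatTrans.app ((D.map f).toFunctor.obj X) ≫
          (Cat.Hom.toNatIso (D.mapComp f h)).inv.app X :=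
    congrArg (fun t => t.toNatTrans.app X) (D.map₂_whisker_left f α)
  rw [e, isIso_comp_left_iff, isIso_comp_right_iff]

theorem isIso_map₂_whiskerRight (D : PDer.{u, v, w}) {a b c : (Cat.{u, u})ᵒᵖ}
    {f g : a ⟶ b} (α : f ⟶ g) (h : b ⟶ c) (X : D.obj a)
    (hX : IsIso ((D.map₂ α).toNatTrans.app X)) :
    IsIso ((D.map₂ (α ▷ h)).toNatTrans.app X) := by
  have e : (D.map₂ (α ▷ h)).toNatTrans.app X =
      (Cat.Hom.toNatIso (D.mapComp f h)).hom.app X ≫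
        (D.map h).toFunctor.map ((D.map₂ α).toNatTrans.app X) ≫
          (Cat.Hom.toNatIso (D.mapComp g h)).inv.app X :=
    congrArg (fun t => t.toNatTrans.app X) (D.map₂_whisker_right α h)
  rw [e, isIso_comp_left_iff, isIso_comp_right_iff]
  infer_instance

instance (D : PDer.{u, v, w}) {E : Type u} [SmallCategory E] (W : MorphismProperty E) :
    (invertedProp D W).IsClosedUnderMapObj where
  map_obj {A B X} hX g x y f hf := by
    rw [← isIso_map₂_whiskerLeft]
    let c (z : E) : (prodLeft E).map g ≫ sect z B ≅ sect z A ≫ g :=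
      opIso (NatIso.ofComponents (fun a => Iso.refl _) (fun {a b} h => Prod.ext
        (by exact (by simp : 𝟙 z ≫ 𝟙 z = 𝟙 z ≫ 𝟙 z))
        (by exact (by simp : g.unop.toFunctor.map h ≫ 𝟙 _ = 𝟙 _ ≫ g.unop.toFunctor.map h))))
    have e : (prodLeft E).map g ◁ sectMap f B = (c x).hom ≫ sectMap f A ▷ g ≫ (c y).inv :=
      op_hom₂_ext fun b => Prod.ext
        (by exact (by simp : f = 𝟙 _ ≫ f ≫ 𝟙 _))
        (by exact (by simp : g.unop.toFunctor.map (𝟙 b) = 𝟙 _ ≫ 𝟙 _ ≫ 𝟙 _))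
    have e' : (D.map₂ ((prodLeft E).map g ◁ sectMap f B)).toNatTrans.app X =
        (Cat.Hom.toNatIso (D.map₂Iso (c x))).hom.app X ≫
          (D.map₂ (sectMap f A ▷ g)).toNatTrans.app X ≫
            (Cat.Hom.toNatIso (D.map₂Iso (c y))).inv.app X := by
      rw [e, D.map₂_comp, D.map₂_comp]
      rfl
    rw [e', isIso_comp_left_iff, isIso_comp_right_iff]
    exact isIso_map₂_whiskerRight D _ _ _ (hX f hf)

theorem invertedProp_map {E : Type u} [SmallCategory E] (W : MorphismProperty E)
    {D D' : PDer.{u, v, w}} (η : D ⟶ D') (A : (Cat.{u, u})ᵒᵖ) (X : D.obj ((prodLeft E).obj A))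
    (hX : (invertedProp D W).prop A X) :
    (invertedProp D' W).prop A ((η.app ((prodLeft E).obj A)).toFunctor.obj X) := by
  intro x y f hf
  have h : (η.app A).toFunctor.map ((D.map₂ (sectMap f A)).toNatTrans.app X) ≫
      (Cat.Hom.toNatIso (η.naturality (sect y A))).hom.app X =
      (Cat.Hom.toNatIso (η.naturality (sect x A))).hom.app X ≫
        (D'.map₂ (sectMap f A)).toNatTrans.app ((η.app ((prodLeft E).obj A)).toFunctor.obj X) :=
    congrArg (fun t => t.toNatTrans.app X) (η.naturality_naturality (sectMap f A))
  have := hX f hf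
  rw [← isIso_comp_left_iff ((Cat.Hom.toNatIso (η.naturality (sect x A))).hom.app X), ← h]
  infer_instance

theorem invertedProp_restrict {E F : Type u} [SmallCategory E] [SmallCategory F] (k : E ⥤ F)
    (W : MorphismProperty E) (hW : W.IsInvertedBy k)
    (D : PDer.{u, v, w}) (A : (Cat.{u, u})ᵒᵖ) (X : D.obj ((prodLeft F).obj A)) :
    (invertedProp D W).prop A ((D.map ((prodLeftMap k).app A)).toFunctor.obj X) := by
  intro x y f hf
  rw [← isIso_map₂_whiskerLeft]
  have : IsIso (k.map f) := hW f hf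
  let i : k.obj x ≅ k.obj y := asIso (k.map f)
  let c : (prodLeftMap k).app A ≫ sect x A ≅ (prodLeftMap k).app A ≫ sect y A :=
    opIso (NatIso.ofComponents (fun a => Iso.prod i (Iso.refl a))
      (fun {a b} g => Prod.ext
        (by exact (by simp : k.map (𝟙 x) ≫ k.map f = k.map f ≫ k.map (𝟙 y)))
        (by exact (by simp : g ≫ 𝟙 b = 𝟙 a ≫ g))))
  have e : (prodLeftMap k).app A ◁ sectMap f A = c.hom := op_hom₂_ext fun b => rfl
  rw [e]
  exact inferInstanceAs (IsIso ((Cat.Hom.toNatIso (D.map₂Iso c)).hom.app X))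

/-- The 2-functor `D ↦ D^E` on prederivators, where `D^E(A) = D(E × A)`. -/
abbrev shiftFunctor (E : Type u) [SmallCategory E] : PDer.{u, v, w} ⥤ᵖ PDer.{u, v, w} :=
  PseudoWhisker.precomp (prodLeft E)

/-- The 2-functor `D ↦ D^{E,W}`, the full sub-prederivator of `D^E` spanned by the diagrams `X` such
that `X_x ⟶ X_y` is an isomorphism for all `x ⟶ y` in `W`. -/
abbrev invertedShiftFunctor {E : Type u} [SmallCategory E] (W : MorphismProperty E) :
    PDer.{u, v, w} ⥤ᵖ PDer.{u, v, w} :=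
  PseudoWhisker.sub (shiftFunctor E) (fun D => invertedProp D W)
    (fun η A X hX => invertedProp_map W η A X hX)

/-- The restriction `k^* : D^F ⟶ D^E`, pseudo-natural in `D`. -/
abbrev restrictTrans {E F : Type u} [SmallCategory E] [SmallCategory F] (k : E ⥤ F) :
    shiftFunctor.{u, v, w} F ⟶ shiftFunctor E :=
  PseudoWhisker.precompTrans (prodLeftMap k)

/-- If `k : E ⥤ F` inverts `W`, the restriction `k^* : D^F ⟶ D^{E,W}`, pseudo-natural in `D`
(with respect to arbitrary morphisms of prederivators). -/
abbrev restrictInverted {E F : Type u} [SmallCategory E] [SmallCategory F] (k : E ⥤ F)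
    (W : MorphismProperty E) (hW : W.IsInvertedBy k) :
    shiftFunctor.{u, v, w} F ⟶ invertedShiftFunctor W :=
  PseudoWhisker.subLiftTrans (fun D => invertedProp D W)
    (fun η A X hX => invertedProp_map W η A X hX) (restrictTrans k)
    (fun D A X => invertedProp_restrict k W hW D A X)

/-! ### The shapes -/

/-- The discrete category `n·1` on `n` objects. -/
abbrev Pts (n : ℕ) : Type u := Discrete (ULift.{u} (Fin n))

/-- The `i`-th object of `n·1`. -/
abbrev Pts.obj {n : ℕ} (i : Fin n) : Pts.{u} n := ⟨⟨i⟩⟩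

/-- The functor `n·1 ⥤ C` classifying the objects `y 0, …, y (n-1)` of `C`. -/
abbrev Pts.functor {n : ℕ} {C : Type u} [SmallCategory C] (y : Fin n → C) : Pts.{u} n ⥤ C :=
  Discrete.functor (fun i => y i.down)

/-- The source of valence `n`: the cone on `n·1`, with a new initial object. -/
abbrev Source (n : ℕ) : Type u := WithInitial (Pts.{u} n)

/-- The sink of valence `n`: the cocone on `n·1`, with a new terminal object. -/
abbrev Sink (n : ℕ) : Type u := WithTerminal (Pts.{u} n)

/-- The cone on `n·[1]`, i.e. `n` disjoint arrows `(i, 0) ⟶ (i, 1)` and a new initial object. -/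
abbrev SepSource (n : ℕ) : Type u := WithInitial (Pts.{u} n × AsSmall.{u} (Fin 2))

namespace SepSource

/-- The objects `x_i = (i, 0)`. -/
abbrev x {n : ℕ} (i : Fin n) : SepSource.{u} n :=
  WithInitial.incl.obj (Pts.obj i, AsSmall.up.obj (0 : Fin 2))

/-- The objects `y_i = (i, 1)`. -/
abbrev y {n : ℕ} (i : Fin n) : SepSource.{u} n :=
  WithInitial.incl.obj (Pts.obj i, AsSmall.up.obj (1 : Fin 2))

/-- The arrow `x_i ⟶ y_i`. -/
abbrev edge {n : ℕ} (i : Fin n) : (x i : SepSource.{u} n) ⟶ y i :=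
  WithInitial.incl.map (Prod.mkHom (𝟙 (Pts.obj i)) (AsSmall.up.map (homOfLE (Fin.zero_le 1))))

/-- The inclusion `i ↦ y_i` of the targets of the arrows. -/
abbrev targets (n : ℕ) : Pts.{u} n ⥤ SepSource.{u} n :=
  Pts.functor y

/-- The functor to the source of valence `n` induced by the collapse `n·[1] ⥤ n·1`. -/
abbrev collapse (n : ℕ) : SepSource.{u} n ⥤ Source.{u} n :=
  WithInitial.map (CategoryTheory.Prod.fst (Pts.{u} n) (AsSmall.{u} (Fin 2)))

/-- The images of the arrows `x_i ⟶ y_i` under a functor. -/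
abbrev edges {n : ℕ} {D : Type u} [SmallCategory D] (t : SepSource.{u} n ⥤ D) :
    MorphismProperty D :=
  MorphismProperty.ofHoms (fun i : Fin n => t.map (edge i))

end SepSource

/-- The vertices of the quiver with arrows `x_i ⟶ y_i` and `x_i ⟶ v`. -/
inductive SepSinkVertex (n : ℕ) : Type u
  | x (i : Fin n)
  | y (i : Fin n)
  | v

/-- The arrows of the quiver with arrows `x_i ⟶ y_i` and `x_i ⟶ v`. -/
inductive SepSinkArrow (n : ℕ) : SepSinkVertex.{u} n → SepSinkVertex.{u} n → Type u
  | toY (i : Fin n) : SepSinkArrow n (.x i) (.y i)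
  | toV (i : Fin n) : SepSinkArrow n (.x i) .v

instance (n : ℕ) : Quiver.{u} (SepSinkVertex.{u} n) where
  Hom := SepSinkArrow n

/-- The free category on the quiver with arrows `x_i ⟶ y_i` and `x_i ⟶ v`. -/
abbrev SepSink (n : ℕ) : Type u := Paths (SepSinkVertex.{u} n)

namespace SepSink

/-- The arrow `x_i ⟶ y_i`. -/
abbrev edge {n : ℕ} (i : Fin n) :
    (Paths.of (SepSinkVertex.{u} n)).obj (.x i) ⟶ (Paths.of (SepSinkVertex.{u} n)).obj (.y i) :=
  (Paths.of (SepSinkVertex.{u} n)).map (SepSinkArrow.toY i)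

/-- The inclusion `i ↦ y_i`. -/
abbrev targets (n : ℕ) : Pts.{u} n ⥤ SepSink.{u} n :=
  Pts.functor (fun i => (Paths.of (SepSinkVertex.{u} n)).obj (.y i))

/-- The functor to the sink of valence `n` sending `x_i` and `y_i` to `i`, and `v` to the terminal
object. -/
abbrev collapse (n : ℕ) : SepSink.{u} n ⥤ Sink.{u} n :=
  Paths.lift
    { obj := fun
        | .x i => WithTerminal.incl.obj (Pts.obj i)
        | .y i => WithTerminal.incl.obj (Pts.obj i)
        | .v => WithTerminal.star
      map := fun
        | .toY i => 𝟙 (WithTerminal.incl.obj (Pts.obj i))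
        | .toV i => WithTerminal.starTerminal.from (WithTerminal.incl.obj (Pts.obj i)) }

/-- The images of the arrows `x_i ⟶ y_i` under a functor. -/
abbrev edges {n : ℕ} {D : Type u} [SmallCategory D] (t : SepSink.{u} n ⥤ D) :
    MorphismProperty D :=
  MorphismProperty.ofHoms (fun i : Fin n => t.map (edge i))

end SepSink

end

/-!
Both functors `u⁺` and `u⁻` are shown to be *homotopical localizations* at the class `W` of the edges
`x_i ⟶ y_i`: for every derivator `D`, restriction along `u` is fully faithful and every diagram
inverting `W` lies in its essential image (`IsHomotopicalLocalization`). The same is shown for `u × A`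
and the arrows of `W` times isomorphisms of `A`, for every small category `A`. The three assertions
follow formally: the essential image of `(u × A)^*` consists of the diagrams that invert `W` because `u`
inverts `W`, and a pseudo-natural transformation between `Cat`-valued pseudofunctors is an equivalence
as soon as its components are equivalences of categories (`PseudoEquiv.equivalence`).

For `u⁻` no Kan extension is needed. The initial object of the source maps to every `x_i`, so it maps
to every `y_i` through the edge, and `u⁻` has a section `s` with `s(i) = y_i`. The edges form a
transformation `𝟭 ⟶ u⁻ ⋙ s`, whose components are edges or isomorphisms; hence `s^*` is inverse to
`(u⁻)^*` on the diagrams inverting `W` (`IsHomotopicalLocalization.of_section`). Section and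
transformation come from the universal properties of the pushouts, the latter as a functor to a
category of arrows.

For `u = u⁺` the counit `u^* u_* X ⟶ X` is shown to be invertible for all `X` inverting `W`; as `u` is
surjective on objects, the unit is then invertible as well. Pushouts being unique up to isomorphism, it
suffices to treat explicit models of `D⁺` and `C⁺`. Isomorphisms are detected pointwise, and on
diagrams inverting `W` the value at `x_i` can be replaced by that at `y_i`, so that only the objects
`c` of `C` and the vertex of the sink have to be considered. There the value of `u_* X` is a limit over
the slice category `(u(d) / u)`, and the counit is the component of the limiting cone at the object
`j₀ = (d, 𝟙)`. If `d` is the vertex, the slice is the terminal category. If `d = c` lies in `C`, it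
contains besides `(c', c ⟶ c')` the objects `(x_i, c ⟶ y_i)` and `(vertex, c ⟶ y_i ⟶ vertex)`. The
former maps to `(y_i, c ⟶ y_i)` and to the latter, which gives a zigzag of endofunctors
`const j₀ ⟶ κ ⟵ ρ ⟶ 𝟭` whose middle arrow consists of edges and identities and is therefore inverted by
the diagram. Such a zigzag exhibits the value at `j₀` as the limit
(`PDer.isIso_eval_of_zigzag`), just as an initial object `j₀` would.
-/

noncomputable section

/-! ### The calculus of restriction functors -/

namespace PDer

section Calculus

variable (D : PDer.{u, v, w}) {P Q R S : Type u} [SmallCategory P] [SmallCategory Q]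
  [SmallCategory R] [SmallCategory S]

theorem resTrans_id (f : P ⥤ Q) : D.resTrans (𝟙 f) = 𝟙 (D.res f) :=
  congrArg (fun t => t.toNatTrans) (D.map₂_id f.toCatHom.op)

theorem resTrans_comp {f g h : P ⥤ Q} (α : f ⟶ g) (β : g ⟶ h) :
    D.resTrans (α ≫ β) = D.resTrans α ≫ D.resTrans β :=
  congrArg (fun t => t.toNatTrans) (D.map₂_comp (Bicategory.Opposite.op2 α.toCatHom₂)
    (Bicategory.Opposite.op2 β.toCatHom₂))

theorem resTrans_comp_app {f g h : P ⥤ Q} (α : f ⟶ g) (β : g ⟶ h) (X : D.Diag Q) :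
    (D.resTrans (α ≫ β)).app X = (D.resTrans α).app X ≫ (D.resTrans β).app X := by
  rw [resTrans_comp]; rfl

/-- The natural isomorphism `f^* ≅ g^*` induced by `f ≅ g`. -/
def resIso {f g : P ⥤ Q} (e : f ≅ g) : D.res f ≅ D.res g where
  hom := D.resTrans e.hom
  inv := D.resTrans e.inv
  hom_inv_id := by rw [← resTrans_comp, e.hom_inv_id, resTrans_id]
  inv_hom_id := by rw [← resTrans_comp, e.inv_hom_id, resTrans_id]

instance {f g : P ⥤ Q} (α : f ⟶ g) [IsIso α] : IsIso (D.resTrans α) :=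
  (D.resIso (asIso α)).isIso_hom

/-- The structure isomorphism `(𝟭 P)^* ≅ 𝟭 (D(P))`. -/
def resId (P : Type u) [SmallCategory P] : D.res (𝟭 P) ≅ 𝟭 (D.Diag P) :=
  Cat.Hom.toNatIso (D.mapId (op (Cat.of P)))

theorem resTrans_whiskerLeft_app (f : P ⥤ Q) {g h : Q ⥤ R} (α : g ⟶ h) (X : D.Diag R) :
    (D.resTrans (Functor.whiskerLeft f α)).app X = (D.resComp f g).hom.app X ≫
      (D.res f).map ((D.resTrans α).app X) ≫ (D.resComp f h).inv.app X :=
  congrArg (fun t => t.toNatTrans.app X)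
    (D.map₂_whisker_right (Bicategory.Opposite.op2 α.toCatHom₂) f.toCatHom.op)

theorem resTrans_whiskerRight_app {f g : P ⥤ Q} (α : f ⟶ g) (h : Q ⥤ R) (X : D.Diag R) :
    (D.resTrans (Functor.whiskerRight α h)).app X = (D.resComp f h).hom.app X ≫
      (D.resTrans α).app ((D.res h).obj X) ≫ (D.resComp g h).inv.app X :=
  congrArg (fun t => t.toNatTrans.app X)
    (D.map₂_whisker_left h.toCatHom.op (Bicategory.Opposite.op2 α.toCatHom₂))

theorem isIso_resTrans_whiskerLeft_iff (f : P ⥤ Q) {g h : Q ⥤ R} (α : g ⟶ h) (X : D.Diag R) :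
    IsIso ((D.resTrans (Functor.whiskerLeft f α)).app X) ↔
      IsIso ((D.res f).map ((D.resTrans α).app X)) := by
  rw [resTrans_whiskerLeft_app, isIso_comp_left_iff, isIso_comp_right_iff]

theorem isIso_resTrans_whiskerRight_iff {f g : P ⥤ Q} (α : f ⟶ g) (h : Q ⥤ R) (X : D.Diag R) :
    IsIso ((D.resTrans (Functor.whiskerRight α h)).app X) ↔
      IsIso ((D.resTrans α).app ((D.res h).obj X)) := by
  rw [resTrans_whiskerRight_app, isIso_comp_left_iff, isIso_comp_right_iff]

theorem isIso_res_comp_map_iff (f : P ⥤ Q) (g : Q ⥤ R) {X Y : D.Diag R} (φ : X ⟶ Y) :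
    IsIso ((D.res (f ⋙ g)).map φ) ↔ IsIso ((D.res f).map ((D.res g).map φ)) :=
  NatIso.isIso_map_iff (D.resComp f g) φ

theorem resComp_id_left_app (f : P ⥤ Q) (X : D.Diag Q) :
    (D.resComp (𝟭 P) f).hom.app X ≫ (D.resId P).hom.app ((D.res f).obj X) =
      (D.resTrans f.leftUnitor.hom).app X := by
  have h := congrArg (fun t => t.toNatTrans.app X) (D.map₂_right_unitor f.toCatHom.op)
  have h' : (D.resTrans f.leftUnitor.hom).app X = (D.resComp (𝟭 P) f).hom.app X ≫
      (D.resId P).hom.app ((D.res f).obj X) ≫ 𝟙 _ := h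
  rw [h', Category.comp_id]

theorem resComp_id_right_app (f : P ⥤ Q) (X : D.Diag Q) :
    (D.resComp f (𝟭 Q)).hom.app X ≫ (D.res f).map ((D.resId Q).hom.app X) =
      (D.resTrans f.rightUnitor.hom).app X := by
  have h := congrArg (fun t => t.toNatTrans.app X) (D.map₂_left_unitor f.toCatHom.op)
  have h' : (D.resTrans f.rightUnitor.hom).app X = (D.resComp f (𝟭 Q)).hom.app X ≫
      (D.res f).map ((D.resId Q).hom.app X) ≫ 𝟙 _ := h
  rw [h', Category.comp_id]

theorem resComp_assoc_app (f : P ⥤ Q) (g : Q ⥤ R) (h : R ⥤ S) (X : D.Diag S) :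
    (D.resComp (f ⋙ g) h).hom.app X ≫ (D.resComp f g).hom.app ((D.res h).obj X) =
      (D.resTrans (Functor.associator f g h).hom).app X ≫ (D.resComp f (g ⋙ h)).hom.app X ≫
        (D.res f).map ((D.resComp g h).hom.app X) := by
  have e := congrArg (fun t => t.toNatTrans.app X)
    (D.map₂_associator h.toCatHom.op g.toCatHom.op f.toCatHom.op)
  have e' : (D.resTrans (Functor.associator f g h).inv).app X = (D.resComp f (g ⋙ h)).hom.app X ≫
      (D.res f).map ((D.resComp g h).hom.app X) ≫ 𝟙 _ ≫
        (D.resComp f g).inv.app ((D.res h).obj X) ≫ (D.resComp (f ⋙ g) h).inv.app X := e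
  have e'' : (D.resTrans (Functor.associator f g h).hom).app X ≫
      (D.resTrans (Functor.associator f g h).inv).app X = 𝟙 _ := by
    rw [← resTrans_comp_app, Iso.hom_inv_id, resTrans_id]; rfl
  rw [e', Category.id_comp] at e''
  have e₃ := e'' =≫ ((D.resComp (f ⋙ g) h).hom.app X ≫ (D.resComp f g).hom.app ((D.res h).obj X))
  simp only [Category.assoc, Iso.inv_hom_id_app_assoc, Iso.inv_hom_id_app] at e₃
  rw [Category.id_comp] at e₃
  rw [← e₃]
  congr 2
  simp

end Calculus

/-! ### Limiting cones and zigzags of endofunctors -/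

section Cone

variable (D : PDer.{u, v, w}) {J : Type u} [SmallCategory J]

/-- The unique 2-cell between two functors to the terminal category. -/
abbrev toPUnit {P : Type u} [SmallCategory P] (f g : P ⥤ Discrete PUnit.{u + 1}) : f ⟶ g :=
  (Functor.punitExt f g).hom

theorem toPUnit_unique {P : Type u} [SmallCategory P] {f g : P ⥤ Discrete PUnit.{u + 1}}
    (α β : f ⟶ g) : α = β := by
  ext x; apply Subsingleton.elim

variable {L : D.Diag (Discrete PUnit.{u + 1})} {Y : D.Diag J}
  (γ : (D.res (Functor.star.{u} J)).obj L ⟶ Y)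

/-- Let `π : J ⥤ 1`. As `π` and `f ⋙ π` are canonically isomorphic for every `f : J ⥤ J`, a cone
`γ : π^* L ⟶ Y` induces `π^* L ≅ f^* π^* L ⟶ f^* Y`. -/
def pullCone (f : J ⥤ J) : (D.res (Functor.star.{u} J)).obj L ⟶ (D.res f).obj Y :=
  (D.resTrans (toPUnit (Functor.star J) (f ⋙ Functor.star J))).app L ≫
    (D.resComp f (Functor.star J)).hom.app L ≫ (D.res f).map γ

theorem pullCone_naturality {f g : J ⥤ J} (σ : f ⟶ g) :
    D.pullCone γ f ≫ (D.resTrans σ).app Y = D.pullCone γ g := by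
  have h := D.resTrans_whiskerRight_app σ (Functor.star J) L
  have h₁ : toPUnit (Functor.star J) (g ⋙ Functor.star J) =
      toPUnit (Functor.star J) (f ⋙ Functor.star J) ≫ Functor.whiskerRight σ (Functor.star J) :=
    toPUnit_unique _ _
  rw [pullCone, pullCone, h₁, resTrans_comp_app, h]
  simp only [Category.assoc, Iso.inv_hom_id_app_assoc]
  rw [(D.resTrans σ).naturality]

theorem pullCone_id : D.pullCone γ (𝟭 J) ≫ (D.resId J).hom.app Y = γ := by
  have h := (D.resId J).hom.naturality γ
  have h₁ := D.resComp_id_left_app (Functor.star J) L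
  have h₂ : (D.resTrans (toPUnit (Functor.star J) (𝟭 J ⋙ Functor.star J))).app L ≫
      (D.resTrans (Functor.star J).leftUnitor.hom).app L = 𝟙 _ := by
    rw [← resTrans_comp_app, toPUnit_unique (toPUnit _ _ ≫ _) (𝟙 _), resTrans_id]; rfl
  rw [pullCone, Category.assoc, Category.assoc]
  erw [h]
  rw [reassoc_of% h₁, reassoc_of% h₂]
  rfl

/-- The unit `L ≅ j₀^* π^* L`, for `π : J ⥤ 1` and an object `j₀` of `J`. -/
def unitStar (j₀ : J) : L ⟶ (D.eval j₀).obj ((D.res (Functor.star.{u} J)).obj L) :=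
  (D.resId _).inv.app L ≫
    (D.resTrans (toPUnit (𝟭 _) (Functor.fromPUnit.{u} j₀ ⋙ Functor.star J))).app L ≫
      (D.resComp (Functor.fromPUnit.{u} j₀) (Functor.star J)).hom.app L

instance (j₀ : J) : IsIso (D.unitStar (L := L) j₀) := by
  unfold unitStar; infer_instance

theorem pullCone_const (j₀ : J) :
    D.pullCone γ (Functor.star.{u} J ⋙ Functor.fromPUnit.{u} j₀) =
      (D.res (Functor.star.{u} J)).map (D.unitStar j₀ ≫ (D.eval j₀).map γ) ≫
        (D.resComp (Functor.star.{u} J) (Functor.fromPUnit.{u} j₀)).inv.app Y := by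
  have h : (D.res (Functor.star.{u} J ⋙ Functor.fromPUnit.{u} j₀)).map γ =
      (D.resComp (Functor.star.{u} J) (Functor.fromPUnit.{u} j₀)).hom.app _ ≫
        (D.res (Functor.star.{u} J)).map ((D.eval j₀).map γ) ≫
          (D.resComp (Functor.star.{u} J) (Functor.fromPUnit.{u} j₀)).inv.app Y :=
    (NatIso.naturality_2 (D.resComp (Functor.star.{u} J) (Functor.fromPUnit.{u} j₀)) γ).symm
  have h₁ := D.resComp_assoc_app (Functor.star.{u} J) (Functor.fromPUnit.{u} j₀)
    (Functor.star.{u} J) L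
  have h₂ := D.resTrans_whiskerLeft_app (Functor.star.{u} J)
    (toPUnit (𝟭 _) (Functor.fromPUnit.{u} j₀ ⋙ Functor.star J)) L
  have h₃ := D.resComp_id_right_app (Functor.star.{u} J) L
  have h₄ : toPUnit (Functor.star J)
      ((Functor.star.{u} J ⋙ Functor.fromPUnit.{u} j₀) ⋙ Functor.star J) ≫
        (Functor.associator _ _ _).hom = (Functor.rightUnitor _).inv ≫
          Functor.whiskerLeft (Functor.star.{u} J)
            (toPUnit (𝟭 _) (Functor.fromPUnit.{u} j₀ ⋙ Functor.star J)) := toPUnit_unique _ _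
  have h₅ : (D.resTrans (Functor.star.{u} J).rightUnitor.inv).app L ≫
      (D.resTrans (Functor.star.{u} J).rightUnitor.hom).app L = 𝟙 _ := by
    rw [← resTrans_comp_app, Iso.inv_hom_id, resTrans_id]; rfl
  have h₆ : (D.resTrans (Functor.star.{u} J).rightUnitor.inv).app L ≫
      (D.resComp (Functor.star.{u} J) (𝟭 _)).hom.app L =
        (D.res (Functor.star.{u} J)).map ((D.resId _).inv.app L) := by
    rw [← h₃] at h₅
    rw [← cancel_mono ((D.res (Functor.star.{u} J)).map ((D.resId _).hom.app L)), Category.assoc,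
      h₅, ← Functor.map_comp, Iso.inv_hom_id_app]
    exact (CategoryTheory.Functor.map_id _ _).symm
  rw [pullCone, h, reassoc_of% h₁, ← reassoc_of% (D.resTrans_comp_app), h₄]
  rw [resTrans_comp_app, h₂]
  simp only [Category.assoc, Iso.inv_hom_id_app_assoc]
  rw [reassoc_of% h₆, unitStar]
  simp only [Functor.map_comp, Category.assoc]

/-- Let `const j₀ ⟶ κ ⟵ ρ ⟶ 𝟭` be a zigzag of endofunctors of `J` whose outer arrows are invertible
at `j₀`, and let `Y` be a diagram on `J` that inverts the middle arrow. Then `Y` is determined by its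
value at `j₀` as far as limits are concerned: the component at `j₀` of any limiting cone on `Y` is
invertible. -/
theorem isIso_eval_of_zigzag (j₀ : J) {κ ρ : J ⥤ J}
    (δ : Functor.star.{u} J ⋙ Functor.fromPUnit.{u} j₀ ⟶ κ) (β : ρ ⟶ κ) (α : ρ ⟶ 𝟭 J)
    [IsIso (δ.app j₀)] [IsIso (α.app j₀)] [IsIso ((D.resTrans β).app Y)]
    (hγ : ∀ Z : D.Diag (Discrete PUnit.{u + 1}),
      Function.Bijective (fun g : Z ⟶ L => (D.res (Functor.star.{u} J)).map g ≫ γ)) :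
    IsIso ((D.eval j₀).map γ) := by
  -- The zigzag defines a cone on `Y` with vertex `Y_{j₀}`, invertible at `j₀`.
  let θ : (D.res (Functor.star.{u} J)).obj ((D.eval j₀).obj Y) ⟶ Y :=
    (D.resComp (Functor.star.{u} J) (Functor.fromPUnit.{u} j₀)).inv.app Y ≫
      (D.resTrans δ).app Y ≫ inv ((D.resTrans β).app Y) ≫ (D.resTrans α).app Y ≫
        (D.resId J).hom.app Y
  have hθ : IsIso ((D.eval j₀).map θ) := by
    have h₁ : IsIso ((D.eval j₀).map ((D.resTrans δ).app Y)) := by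
      rw [← isIso_resTrans_whiskerLeft_iff]
      have : IsIso (Functor.whiskerLeft (Functor.fromPUnit.{u} j₀) δ) := by
        have (x : Discrete PUnit.{u + 1}) :
          IsIso ((Functor.whiskerLeft (Functor.fromPUnit.{u} j₀) δ).app x) :=
        inferInstanceAs (IsIso (δ.app j₀))
        exact NatIso.isIso_of_isIso_app _
      infer_instance
    have h₂ : IsIso ((D.eval j₀).map ((D.resTrans α).app Y)) := by
      rw [← isIso_resTrans_whiskerLeft_iff]
      have : IsIso (Functor.whiskerLeft (Functor.fromPUnit.{u} j₀) α) := by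
        have (x : Discrete PUnit.{u + 1}) :
          IsIso ((Functor.whiskerLeft (Functor.fromPUnit.{u} j₀) α).app x) :=
        inferInstanceAs (IsIso (α.app j₀))
        exact NatIso.isIso_of_isIso_app _
      infer_instance
    simp only [θ, Functor.map_comp]
    infer_instance
  obtain ⟨g, hg⟩ := (hγ _).2 θ
  dsimp only at hg
  -- Following `γ` along the zigzag shows that `g` is a retraction of `j₀^* γ`, up to `unitStar`.
  have e : D.unitStar j₀ ≫ (D.eval j₀).map γ ≫ g = 𝟙 L := by
    apply (hγ L).1
    dsimp only
    have e₁ : D.pullCone γ (Functor.star.{u} J ⋙ Functor.fromPUnit.{u} j₀) ≫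
        (D.resTrans δ).app Y ≫ inv ((D.resTrans β).app Y) ≫ (D.resTrans α).app Y ≫
          (D.resId J).hom.app Y = γ := by
      rw [reassoc_of% (D.pullCone_naturality γ δ), ← D.pullCone_naturality γ β, Category.assoc,
        IsIso.hom_inv_id_assoc, reassoc_of% (D.pullCone_naturality γ α), pullCone_id]
    rw [pullCone_const, Category.assoc] at e₁
    rw [CategoryTheory.Functor.map_id, Category.id_comp, ← Category.assoc, Functor.map_comp,
      Category.assoc, hg]
    exact e₁
  have : IsSplitMono ((D.eval j₀).map γ) :=
    ⟨⟨g ≫ D.unitStar j₀, by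
      rw [← cancel_epi (D.unitStar (L := L) j₀), ← Category.assoc, ← Category.assoc,
        Category.assoc (D.unitStar j₀), e, Category.id_comp, Category.comp_id]⟩⟩
  -- As `θ` factors through `γ` and is invertible at `j₀`, the morphism `j₀^* γ` is an epimorphism.
  have : Epi ((D.eval j₀).map γ) := by
    have : Epi ((D.eval j₀).map ((D.res (Functor.star.{u} J)).map g) ≫ (D.eval j₀).map γ) := by
      rw [← Functor.map_comp, hg]; infer_instance
    exact epi_of_epi ((D.eval j₀).map ((D.res (Functor.star.{u} J)).map g)) _
  exact isIso_of_epi_of_isSplitMono _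

end Cone

end PDer

/-! ### Diagrams inverting a class of arrows -/

namespace PDer

/-- An arrow of `P`, as a natural transformation between functors out of the terminal category. -/
abbrev arrowTrans {P : Type u} [SmallCategory P] {x y : P} (f : x ⟶ y) :
    Functor.fromPUnit.{u} x ⟶ Functor.fromPUnit.{u} y where
  app _ := f
  naturality _ _ _ := (Category.id_comp f).trans (Category.comp_id f).symm

section

variable (D : PDer.{u, v, w}) {P Q R : Type u} [SmallCategory P] [SmallCategory Q]
  [SmallCategory R]

/-- The diagrams `X` on `P` such that `X_x ⟶ X_y` is invertible for every `x ⟶ y` in `W`. -/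
def Inverts (W : MorphismProperty P) : ObjectProperty (D.Diag P) :=
  fun X => ∀ ⦃x y : P⦄ (f : x ⟶ y), W f → IsIso ((D.resTrans (arrowTrans f)).app X)

theorem isIso_resTrans_congr {f g f' g' : P ⥤ Q} (σ : f ⟶ g) (σ' : f' ⟶ g') (e : f ≅ f')
    (e' : g ≅ g') (h : σ ≫ e'.hom = e.hom ≫ σ') (X : D.Diag Q) :
    IsIso ((D.resTrans σ).app X) ↔ IsIso ((D.resTrans σ').app X) := by
  have h₁ := congrArg (fun t => (D.resTrans t).app X) h
  simp only [resTrans_comp_app] at h₁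
  rw [← isIso_comp_right_iff _ ((D.resTrans e'.hom).app X), h₁, isIso_comp_left_iff]

/-- The restriction of `f : P ⥤ Q` along the functor classifying `p` classifies `f p`. -/
def fromPUnitComp (p : P) (f : P ⥤ Q) :
    Functor.fromPUnit.{u} p ⋙ f ≅ Functor.fromPUnit.{u} (f.obj p) :=
  NatIso.ofComponents (fun _ => Iso.refl _)

theorem isIso_resTrans_arrowTrans_app_iff {f g : P ⥤ Q} (σ : f ⟶ g) (p : P) (X : D.Diag Q) :
    IsIso ((D.eval p).map ((D.resTrans σ).app X)) ↔
      IsIso ((D.resTrans (arrowTrans (σ.app p))).app X) := by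
  rw [← isIso_resTrans_whiskerLeft_iff]
  exact D.isIso_resTrans_congr _ _ (fromPUnitComp p f) (fromPUnitComp p g)
    (by ext; simp [fromPUnitComp]) X

theorem isIso_arrowTrans_res_iff (f : P ⥤ Q) {x y : P} (g : x ⟶ y) (X : D.Diag Q) :
    IsIso ((D.resTrans (arrowTrans g)).app ((D.res f).obj X)) ↔
      IsIso ((D.resTrans (arrowTrans (f.map g))).app X) := by
  rw [← isIso_resTrans_whiskerRight_iff]
  exact D.isIso_resTrans_congr _ _ (fromPUnitComp x f) (fromPUnitComp y f)
    (by ext; simp [fromPUnitComp]) X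

theorem isIso_eval_res_map_iff (f : P ⥤ Q) (p : P) {X Y : D.Diag Q} (φ : X ⟶ Y) :
    IsIso ((D.eval p).map ((D.res f).map φ)) ↔ IsIso ((D.eval (f.obj p)).map φ) := by
  rw [← isIso_res_comp_map_iff]
  exact NatIso.isIso_map_iff (D.resIso (fromPUnitComp p f)) φ

theorem isIso_arrowTrans_of_isIso {x y : P} (f : x ⟶ y) [IsIso f] (X : D.Diag P) :
    IsIso ((D.resTrans (arrowTrans f)).app X) := by
  have (z : Discrete PUnit.{u + 1}) : IsIso ((arrowTrans f).app z) := inferInstanceAs (IsIso f)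
  have := NatIso.isIso_of_isIso_app (arrowTrans f)
  infer_instance

variable {D} in
/-- By (Der2), a diagram inverting `W` sees a transformation as invertible if its components lie in `W`
or are isomorphisms. -/
theorem IsDerivator.isIso_resTrans (hD : D.IsDerivator) {W : MorphismProperty Q} {f g : P ⥤ Q}
    (σ : f ⟶ g) {X : D.Diag Q} (hX : D.Inverts W X)
    (h : ∀ p, W (σ.app p) ∨ IsIso (σ.app p)) : IsIso ((D.resTrans σ).app X) := by
  rw [hD.der2]
  intro p
  rw [isIso_resTrans_arrowTrans_app_iff]
  rcases h p with h | h
  · exact hX _ h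
  · exact D.isIso_arrowTrans_of_isIso _ X

theorem inverts_res (f : P ⥤ Q) (W : MorphismProperty P) (hW : W.IsInvertedBy f) (X : D.Diag Q) :
    D.Inverts W ((D.res f).obj X) := by
  intro x y g hg
  rw [isIso_arrowTrans_res_iff]
  have := hW g hg
  exact D.isIso_arrowTrans_of_isIso _ X

/-- Diagrams inverting `f : x ⟶ y` have isomorphic values at `x` and `y`. -/
theorem isIso_eval_of_arrow {x y : P} (f : x ⟶ y) {X Y : D.Diag P} (φ : X ⟶ Y)
    (hX : IsIso ((D.resTrans (arrowTrans f)).app X))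
    (hY : IsIso ((D.resTrans (arrowTrans f)).app Y)) :
    IsIso ((D.eval x).map φ) ↔ IsIso ((D.eval y).map φ) := by
  rw [← isIso_comp_right_iff _ ((D.resTrans (arrowTrans f)).app Y),
    (D.resTrans (arrowTrans f)).naturality φ, isIso_comp_left_iff]

end

/-! ### The zigzag criterion -/

/-- Given `q : J ⥤ A`, a class `W` of arrows of `A` and an object `j₀` of `J`, this is the existence
of endofunctors `κ` and `ρ` of `J` and transformations `const j₀ ⟶ κ ⟵ ρ ⟶ 𝟭` whose outer arrows are
invertible at `j₀` and whose middle arrow becomes invertible once `W` is inverted. -/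
def HasZigzag {J A : Type u} [SmallCategory J] [SmallCategory A] (q : J ⥤ A)
    (W : MorphismProperty A) (j₀ : J) : Prop :=
  ∃ (κ ρ : J ⥤ J) (δ : Functor.star.{u} J ⋙ Functor.fromPUnit.{u} j₀ ⟶ κ) (β : ρ ⟶ κ)
    (α : ρ ⟶ 𝟭 J), IsIso (δ.app j₀) ∧ IsIso (α.app j₀) ∧
      ∀ j, W (q.map (β.app j)) ∨ IsIso (q.map (β.app j))

variable {D : PDer.{u, v, w}} {A B : Type u} [SmallCategory A] [SmallCategory B]

/-- By (Der4), the value of `f_* X` at `f a` is a limit over `(f a / f)`, and the value of the counit at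
`a` is the component of the limiting cone at `(a, 𝟙)`. -/
theorem IsDerivator.isIso_eval_counit (hD : D.IsDerivator) (f : A ⥤ B) {W : MorphismProperty A}
    {ran : D.Diag A ⥤ D.Diag B} (adj : D.res f ⊣ ran) {X : D.Diag A} (hX : D.Inverts W X) (a : A)
    (h : HasZigzag (StructuredArrow.proj (f.obj a) f) W (StructuredArrow.mk (𝟙 (f.obj a)))) :
    IsIso ((D.eval a).map (adj.counit.app X)) := by
  obtain ⟨κ, ρ, δ, β, α, hδ, hα, hβ⟩ := h
  let b := f.obj a
  let j₀ : StructuredArrow b f := StructuredArrow.mk (𝟙 (f.obj a))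
  let q := StructuredArrow.proj b f
  obtain ⟨lim, ⟨adj₂⟩⟩ := hD.der3_right (Functor.star.{u} (StructuredArrow b f))
  have h4 := hD.der4_right f b ran adj lim adj₂
  let sq := D.square (underTrans f b)
  let γ : (D.res (Functor.star.{u} _)).obj ((D.eval b).obj (ran.obj X)) ⟶ (D.res q).obj X :=
    sq.natTrans.app (ran.obj X) ≫ (D.res q).map (adj.counit.app X)
  -- `γ` is a limiting cone: it corresponds to the mate of the slice square, which is invertible.
  have hm : IsIso ((mateEquiv adj adj₂ sq).natTrans.app X) := inferInstance
  have hγ : (D.res (Functor.star.{u} _)).map ((mateEquiv adj adj₂ sq).natTrans.app X) ≫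
      adj₂.counit.app _ = γ := mateEquiv_counit adj adj₂ sq X
  have hlim (Z : D.Diag (Discrete PUnit.{u + 1})) : Function.Bijective
      (fun g : Z ⟶ (D.eval b).obj (ran.obj X) => (D.res (Functor.star.{u} _)).map g ≫ γ) := by
    have e : (fun g : Z ⟶ (D.eval b).obj (ran.obj X) =>
        (D.res (Functor.star.{u} _)).map g ≫ γ) =
        (adj₂.homEquiv Z ((D.res q).obj X)).symm ∘
          (fun g => g ≫ (mateEquiv adj adj₂ sq).natTrans.app X) := by
      funext g
      simp only [Function.comp, Adjunction.homEquiv_counit, Functor.map_comp, Category.assoc]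
      rw [hγ]
    rw [e]
    refine (Equiv.bijective _).comp ⟨fun g g' hg => (cancel_mono _).1 hg, fun g =>
      ⟨g ≫ inv ((mateEquiv adj adj₂ sq).natTrans.app X), by simp⟩⟩
  have hY : IsIso ((D.resTrans β).app ((D.res q).obj X)) := by
    rw [← isIso_resTrans_whiskerRight_iff]
    exact hD.isIso_resTrans _ hX hβ
  have key : IsIso ((D.eval j₀).map γ) := D.isIso_eval_of_zigzag γ j₀ δ β α hlim
  have hsq : IsIso ((D.eval j₀).map (sq.natTrans.app (ran.obj X))) := by
    have h₁ : IsIso ((D.eval j₀).map ((D.resTrans (underTrans f b)).app (ran.obj X))) := by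
      rw [isIso_resTrans_arrowTrans_app_iff]
      exact D.isIso_arrowTrans_of_isIso (𝟙 (f.obj a)) _
    change IsIso ((D.eval j₀).map ((D.resComp _ _).inv.app (ran.obj X) ≫
      (D.resTrans (underTrans f b)).app (ran.obj X) ≫ (D.resComp _ _).hom.app (ran.obj X)))
    rw [Functor.map_comp, Functor.map_comp, isIso_comp_left_iff, isIso_comp_right_iff]
    exact h₁
  rw [Functor.map_comp, isIso_comp_left_iff, isIso_eval_res_map_iff] at key
  exact key

end PDer

/-! ### Homotopical localizations -/

/-- A functor `f : A ⥤ B` is a homotopical localization at `W` if for every derivator `D` the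
restriction `f^* : D(B) ⥤ D(A)` is fully faithful and its essential image contains all diagrams that
invert `W`. -/
structure IsHomotopicalLocalization {A B : Type u} [SmallCategory A] [SmallCategory B] (f : A ⥤ B)
    (W : MorphismProperty A) : Prop where
  full : ∀ D : PDer.{u, v, w}, D.IsDerivator → (D.res f).Full
  faithful : ∀ D : PDer.{u, v, w}, D.IsDerivator → (D.res f).Faithful
  essImage : ∀ D : PDer.{u, v, w}, D.IsDerivator → ∀ X, D.Inverts W X → (D.res f).essImage X

namespace IsHomotopicalLocalization

variable {A B : Type u} [SmallCategory A] [SmallCategory B] {f : A ⥤ B} {W : MorphismProperty A}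

/-- Under the zigzag condition, the counit of `f^* ⊣ f_*` is invertible on the diagrams inverting `W`.
It suffices to have zigzags at sufficiently many objects `a'`, as the value of such a diagram does not
change along arrows in `W`. -/
theorem of_zigzag (hf : Function.Surjective f.obj) (hW : W.IsInvertedBy f)
    (h : ∀ a : A, ∃ (a' : A) (g : a ⟶ a'), (W g ∨ IsIso g) ∧
      PDer.HasZigzag (StructuredArrow.proj (f.obj a') f) W (StructuredArrow.mk (𝟙 (f.obj a')))) :
    IsHomotopicalLocalization.{u, v, w} f W := by
  have main (D : PDer.{u, v, w}) (hD : D.IsDerivator) {ran : D.Diag A ⥤ D.Diag B}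
      (adj : D.res f ⊣ ran) (X : D.Diag A) (hX : D.Inverts W X) : IsIso (adj.counit.app X) := by
    rw [hD.der2]
    intro a
    obtain ⟨a', g, hg, hz⟩ := h a
    have hg' (Y : D.Diag A) (hY : D.Inverts W Y) :
        IsIso ((D.resTrans (PDer.arrowTrans g)).app Y) := by
      rcases hg with hg | hg
      · exact hY g hg
      · exact D.isIso_arrowTrans_of_isIso g Y
    rw [D.isIso_eval_of_arrow g _ (hg' _ (D.inverts_res f W hW _)) (hg' X hX)]
    exact hD.isIso_eval_counit f adj hX a' hz
  have ff (D : PDer.{u, v, w}) (hD : D.IsDerivator) : Nonempty (D.res f).FullyFaithful := by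
    obtain ⟨ran, ⟨adj⟩⟩ := hD.der3_right f
    have (Y : D.Diag B) : IsIso (adj.unit.app Y) := by
      have h₁ : IsIso ((D.res f).map (adj.unit.app Y)) := by
        have := main D hD adj _ (D.inverts_res f W hW Y)
        have e := adj.left_triangle_components Y
        rw [← isIso_comp_right_iff _ (adj.counit.app ((D.res f).obj Y)), e]
        exact IsIso.id _
      rw [hD.der2]
      intro b
      obtain ⟨a, rfl⟩ := hf b
      rw [← D.isIso_eval_res_map_iff f]
      infer_instance
    have := NatIso.isIso_of_isIso_app adj.unit
    exact ⟨adj.fullyFaithfulLOfIsIsoUnit⟩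
  refine ⟨fun D hD => (ff D hD).some.full, fun D hD => (ff D hD).some.faithful,
    fun D hD X hX => ?_⟩
  obtain ⟨ran, ⟨adj⟩⟩ := hD.der3_right f
  have := main D hD adj X hX
  exact ⟨_, ⟨asIso (adj.counit.app X)⟩⟩

/-- If `f` has a section `s` and there is a transformation `𝟭 ⟶ f ⋙ s` with components in `W`, then
`f` is a homotopical localization at `W`: restriction along `s` is inverse to restriction along `f`
on the diagrams inverting `W`. -/
theorem of_section (hW : W.IsInvertedBy f) (s : B ⥤ A) (e : s ⋙ f ≅ 𝟭 B) (σ : 𝟭 A ⟶ f ⋙ s)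
    (hσ : ∀ a, W (σ.app a) ∨ IsIso (σ.app a)) : IsHomotopicalLocalization.{u, v, w} f W := by
  have key (D : PDer.{u, v, w}) (hD : D.IsDerivator) :
      ((D.Inverts W).lift (D.res f) (D.inverts_res f W hW)).IsEquivalence := by
    let F := (D.Inverts W).lift (D.res f) (D.inverts_res f W hW)
    let G := (D.Inverts W).ι ⋙ D.res s
    let η : F ⋙ G ≅ 𝟭 _ := (D.resComp s f).symm ≪≫ D.resIso e ≪≫ D.resId B
    have hτ (X : (D.Inverts W).FullSubcategory) : IsIso ((D.resTrans σ).app X.obj) :=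
      hD.isIso_resTrans σ X.property hσ
    let i' : (D.Inverts W).ι ≅ (G ⋙ F) ⋙ (D.Inverts W).ι :=
      Functor.isoWhiskerLeft (D.Inverts W).ι (D.resId A).symm ≪≫
        (NatIso.ofComponents (fun X => @asIso _ _ _ _ ((D.resTrans σ).app X.obj) (hτ X))
          (fun g => (D.resTrans σ).naturality g.hom) :
            (D.Inverts W).ι ⋙ D.res (𝟭 A) ≅ (D.Inverts W).ι ⋙ D.res (f ⋙ s)) ≪≫
            Functor.isoWhiskerLeft (D.Inverts W).ι (D.resComp f s)
    let i : 𝟭 _ ≅ G ⋙ F := ((D.Inverts W).fullyFaithfulι.whiskeringRight _).preimageIso i'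
    exact (CategoryTheory.Equivalence.mk F G η.symm i.symm).isEquivalence_functor
  refine ⟨fun D hD => ?_, fun D hD => ?_, fun D hD X hX => ?_⟩
  · have := key D hD
    exact inferInstanceAs ((D.Inverts W).lift (D.res f) (D.inverts_res f W hW) ⋙
      (D.Inverts W).ι).Full
  · have := key D hD
    exact inferInstanceAs ((D.Inverts W).lift (D.res f) (D.inverts_res f W hW) ⋙
      (D.Inverts W).ι).Faithful
  · have := key D hD
    let F := (D.Inverts W).lift (D.res f) (D.inverts_res f W hW)
    exact ⟨_, ⟨(D.Inverts W).ι.mapIso (F.objObjPreimageIso ⟨X, hX⟩)⟩⟩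

end IsHomotopicalLocalization

/-! ### Localizations under equivalences and products -/

namespace PDer

/-- Restriction along an equivalence of categories is an equivalence. -/
theorem isEquivalence_res (D : PDer.{u, v, w}) {A B : Type u} [SmallCategory A] [SmallCategory B]
    (e : A ≌ B) : (D.res e.functor).IsEquivalence :=
  (CategoryTheory.Equivalence.mk (D.res e.functor) (D.res e.inverse)
    ((D.resId B).symm ≪≫ D.resIso e.counitIso.symm ≪≫ D.resComp e.inverse e.functor)
    ((D.resComp e.functor e.inverse).symm ≪≫ D.resIso e.unitIso.symm ≪≫
      D.resId A)).isEquivalence_functor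

theorem Inverts.isoClosure {D : PDer.{u, v, w}} {A : Type u} [SmallCategory A]
    {W : MorphismProperty A} {X : D.Diag A} (hX : D.Inverts W X) : D.Inverts W.isoClosure X := by
  rintro x y f ⟨x', y', f', hf', ⟨e⟩⟩
  let i (a b : A) (t : a ≅ b) : Functor.fromPUnit.{u} a ≅ Functor.fromPUnit.{u} b :=
    NatIso.ofComponents (fun _ => t)
  rw [← D.isIso_resTrans_congr (arrowTrans f') (arrowTrans f)
    (i _ _ (Arrow.leftFunc.mapIso e)) (i _ _ (Arrow.rightFunc.mapIso e))]
  · exact hX f' hf'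
  · ext
    exact (Arrow.w_mk_right e.hom).symm

end PDer

/-- The arrows of `A × C` whose first component lies in `W` and whose second component is
invertible. -/
def CategoryTheory.MorphismProperty.prodIsos {A : Type u} [SmallCategory A]
    (W : MorphismProperty A) (C : Type u) [SmallCategory C] : MorphismProperty (A × C) :=
  fun _ _ f => W f.1 ∧ IsIso f.2

theorem CategoryTheory.MorphismProperty.prodIsos_isInvertedBy {A B : Type u} [SmallCategory A]
    [SmallCategory B] {W : MorphismProperty A} {f : A ⥤ B} (hW : W.IsInvertedBy f) (C : Type u)
    [SmallCategory C] : (W.prodIsos C).IsInvertedBy (f.prod (𝟭 C)) := by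
  rintro x y g ⟨h₁, h₂⟩
  rw [isIso_prod_iff]
  exact ⟨hW _ h₁, h₂⟩

theorem CategoryTheory.MorphismProperty.prodIsos_isoClosure_le {A : Type u} [SmallCategory A]
    (W : MorphismProperty A) (C : Type u) [SmallCategory C] :
    W.isoClosure.prodIsos C ≤ (W.prodIsos C).isoClosure := by
  rintro ⟨x, c⟩ ⟨y, c'⟩ ⟨g, t⟩ ⟨⟨x', y', g', hg, ⟨e⟩⟩, ht⟩
  dsimp at g t ht e
  have i : CategoryTheory.Arrow.mk (Prod.mkHom g' t : (x', c) ⟶ (y', c')) ≅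
      CategoryTheory.Arrow.mk (Prod.mkHom g t : (x, c) ⟶ (y, c')) :=
    CategoryTheory.Arrow.isoMk (Iso.prod (CategoryTheory.Arrow.leftFunc.mapIso e) (Iso.refl c))
      (Iso.prod (CategoryTheory.Arrow.rightFunc.mapIso e) (Iso.refl c'))
      (Prod.ext e.hom.w ((Category.id_comp t).trans (Category.comp_id t).symm))
  exact ⟨(x', c), (y', c'), Prod.mkHom g' t, ⟨hg, ht⟩, ⟨i⟩⟩

namespace PDer

section Prod

variable {A B C : Type u} [SmallCategory A] [SmallCategory B] [SmallCategory C]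

/-- The projection `((b, c) / f × C) ⥤ (b / f)`. -/
def underProdFst (f : A ⥤ B) (b : B) (c : C) :
    StructuredArrow (b, c) (f.prod (𝟭 C)) ⥤ StructuredArrow b f where
  obj j := StructuredArrow.mk (Y := j.right.1) j.hom.1
  map φ := StructuredArrow.homMk φ.right.1 (congrArg (fun t => t.1) (StructuredArrow.w φ))

/-- The inclusion `(b / f) ⥤ ((b, c) / f × C)` at the object `𝟙 c` of `c / C`. -/
def underProdIncl (f : A ⥤ B) (b : B) (c : C) :
    StructuredArrow b f ⥤ StructuredArrow (b, c) (f.prod (𝟭 C)) where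
  obj j := StructuredArrow.mk (Y := (j.right, c)) (Prod.mkHom j.hom (𝟙 c))
  map φ := StructuredArrow.homMk (Prod.mkHom φ.right (𝟙 c))
    (Prod.ext (StructuredArrow.w φ) (Category.comp_id _))

/-- As `𝟙 c` is initial in `c / C`, the inclusion is a coreflection. -/
def underProdCounit (f : A ⥤ B) (b : B) (c : C) :
    underProdFst f b c ⋙ underProdIncl f b c ⟶ 𝟭 _ where
  app j := StructuredArrow.homMk (Prod.mkHom (𝟙 _) j.hom.2)
    (Prod.ext (by simp [underProdFst, underProdIncl]) (by simp [underProdFst, underProdIncl]))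
  naturality i j φ := by
    ext
    · simp [underProdFst, underProdIncl]
    · have := congrArg (fun t => t.2) (StructuredArrow.w φ)
      simp at this
      simp [underProdFst, underProdIncl, this]

/-- Zigzags for `f` give zigzags for `f × C`: conjugate with the coreflection `(b / f)` of
`((b, c) / f × C)`. -/
theorem HasZigzag.prod {f : A ⥤ B} {W : MorphismProperty A} {a : A}
    (h : HasZigzag (StructuredArrow.proj (f.obj a) f) W (StructuredArrow.mk (𝟙 (f.obj a))))
    (c : C) : HasZigzag (StructuredArrow.proj ((f.prod (𝟭 C)).obj (a, c)) (f.prod (𝟭 C)))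
      (W.prodIsos C) (StructuredArrow.mk (𝟙 ((f.prod (𝟭 C)).obj (a, c)))) := by
  obtain ⟨κ, ρ, δ, β, α, hδ, hα, hβ⟩ := h
  let F := underProdFst f (f.obj a) c
  let G := underProdIncl f (f.obj a) c
  refine ⟨F ⋙ κ ⋙ G, F ⋙ ρ ⋙ G,
    { app j := G.map (δ.app (F.obj j))
      naturality i j φ := ?_ },
    Functor.whiskerLeft F (Functor.whiskerRight β G),
    Functor.whiskerLeft F (Functor.whiskerRight α G) ≫ underProdCounit f (f.obj a) c, ?_, ?_, ?_⟩
  · have e := δ.naturality (F.map φ)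
    have e' := congrArg (fun t => G.map t) e
    simp only [Functor.map_comp] at e'
    have e'' : G.map ((Functor.star.{u} _ ⋙
        Functor.fromPUnit.{u} (StructuredArrow.mk (𝟙 (f.obj a)))).map (F.map φ)) = 𝟙 _ :=
      G.map_id (StructuredArrow.mk (𝟙 (f.obj a)))
    rw [e''] at e'
    exact e'
  · exact inferInstanceAs (IsIso (G.map (δ.app (StructuredArrow.mk (𝟙 (f.obj a))))))
  · have h₁ : IsIso (G.map (α.app (StructuredArrow.mk (𝟙 (f.obj a))))) := inferInstance
    have h₂ : (underProdCounit f (f.obj a) c).app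
        (StructuredArrow.mk (𝟙 ((f.prod (𝟭 C)).obj (a, c)))) = 𝟙 _ := rfl
    rw [NatTrans.comp_app, h₂]
    exact inferInstanceAs (IsIso (G.map (α.app (StructuredArrow.mk (𝟙 (f.obj a)))) ≫ 𝟙 _))
  · intro j
    rcases hβ (F.obj j) with h | h
    · exact Or.inl ⟨h, inferInstanceAs (IsIso (𝟙 c))⟩
    · refine Or.inr ?_
      rw [isIso_prod_iff]
      exact ⟨h, inferInstanceAs (IsIso (𝟙 c))⟩

end Prod

end PDer

namespace IsHomotopicalLocalization

variable {A B A' B' : Type u} [SmallCategory A] [SmallCategory B] [SmallCategory A']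
  [SmallCategory B'] {f : A ⥤ B} {f' : A' ⥤ B'} {W : MorphismProperty A}
  {W' : MorphismProperty A'}

theorem of_le_isoClosure {W' : MorphismProperty A} (h : IsHomotopicalLocalization.{u, v, w} f W')
    (hW : W' ≤ W.isoClosure) : IsHomotopicalLocalization.{u, v, w} f W :=
  ⟨h.full, h.faithful, fun D hD X hX =>
    h.essImage D hD X (fun _ _ g hg => hX.isoClosure g (hW g hg))⟩

theorem of_equivalence (h : IsHomotopicalLocalization.{u, v, w} f' W') (e : A ≌ A') (d : B ≌ B')
    (i : f ⋙ d.functor ≅ e.functor ⋙ f')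
    (hW : ∀ ⦃x y⦄ (g : x ⟶ y), W' g → W.isoClosure (e.inverse.map g)) :
    IsHomotopicalLocalization.{u, v, w} f W := by
  let i' : f ≅ e.functor ⋙ f' ⋙ d.inverse :=
    f.rightUnitor.symm ≪≫ Functor.isoWhiskerLeft f d.unitIso ≪≫
      (Functor.associator _ _ _).symm ≪≫ Functor.isoWhiskerRight i d.inverse
  have k (D : PDer.{u, v, w}) : (D.res d.inverse ⋙ D.res f') ⋙ D.res e.functor ≅ D.res f :=
    Functor.isoWhiskerRight (D.resComp f' d.inverse).symm _ ≪≫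
      (D.resComp e.functor (f' ⋙ d.inverse)).symm ≪≫ D.resIso i'.symm
  have he (D : PDer.{u, v, w}) := D.isEquivalence_res e
  have hd (D : PDer.{u, v, w}) : (D.res d.inverse).IsEquivalence := D.isEquivalence_res d.symm
  refine ⟨fun D hD => ?_, fun D hD => ?_, fun D hD X hX => ?_⟩
  · have := h.full D hD
    exact Functor.Full.of_iso (k D)
  · have := h.faithful D hD
    exact Functor.Faithful.of_iso (k D)
  · have hX' : D.Inverts W' ((D.res e.inverse).obj X) := by
      intro x y g hg
      rw [PDer.isIso_arrowTrans_res_iff]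
      exact hX.isoClosure _ (hW g hg)
    obtain ⟨Y, ⟨j⟩⟩ := h.essImage D hD _ hX'
    refine ⟨(D.res d.functor).obj Y, ⟨?_⟩⟩
    exact (D.resComp f d.functor).symm.app Y ≪≫ (D.resIso i).app Y ≪≫
      (D.resComp e.functor f').app Y ≪≫ (D.res e.functor).mapIso j ≪≫
        (D.resComp e.functor e.inverse).symm.app X ≪≫ (D.resIso e.unitIso.symm).app X ≪≫
          (D.resId A).app X

end IsHomotopicalLocalization

namespace PDer

/-- An arrow `(g, t)` with `g` in `W` and `t` invertible is the composite of a component of the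
transformation defining the exactness condition and an isomorphism. -/
theorem invertedProp.inverts {D : PDer.{u, v, w}} {E : Type u} [SmallCategory E]
    {W : MorphismProperty E} {C : Type u} [SmallCategory C] {X : D.Diag (E × C)}
    (hX : (invertedProp D W).prop (op (Cat.of C)) X) : D.Inverts (W.prodIsos C) X := by
  rintro ⟨x, c⟩ ⟨y, c'⟩ ⟨g, t⟩ ⟨hg, ht⟩
  dsimp at g t hg ht
  have h₁ := hX g hg
  let σ : Prod.sectR x C ⟶ Prod.sectR y C := (sectMap g (op (Cat.of C))).unop2.toNatTrans
  have h₂ : IsIso ((D.resTrans σ).app X) := h₁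
  have h₃ : IsIso ((D.eval c).map ((D.resTrans σ).app X)) := inferInstance
  rw [isIso_resTrans_arrowTrans_app_iff] at h₃
  have e : D.resTrans (arrowTrans (Prod.mkHom g t : (x, c) ⟶ (y, c'))) =
      D.resTrans (arrowTrans (σ.app c)) ≫
        D.resTrans (arrowTrans (Prod.mkHom (𝟙 y) t : (y, c) ⟶ (y, c'))) := by
    rw [← resTrans_comp]
    congr 1
    ext
    · exact (Category.comp_id g).symm
    · exact (Category.id_comp t).symm
  have h₄ : IsIso (Prod.mkHom (𝟙 y) t : (y, c) ⟶ (y, c')) := by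
    rw [isIso_prod_iff]; exact ⟨inferInstanceAs (IsIso (𝟙 y)), ht⟩
  have h₅ := D.isIso_arrowTrans_of_isIso (Prod.mkHom (𝟙 y) t : (y, c) ⟶ (y, c')) X
  change IsIso ((D.resTrans (arrowTrans (Prod.mkHom g t : (x, c) ⟶ (y, c')))).app X)
  rw [e, NatTrans.comp_app]
  exact IsIso.comp_isIso' h₃ h₅

end PDer

/-! ### Explicit models of the two pushouts with sinks -/

/-- The category `D⁺`: the objects of `C`, objects `x i` with an arrow to `y i`, and an object `apex`
under all `x i`. -/
inductive Separated {n : ℕ} {C : Type u} (y : Fin n → C) : Type u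
  | base (c : C)
  | x (i : Fin n)
  | apex

/-- The category `C⁺`: the objects of `C`, and an object `apex` with an arrow from each `y i`. -/
inductive Attached {n : ℕ} {C : Type u} (y : Fin n → C) : Type u
  | base (c : C)
  | apex

theorem eqToHom_conj_comp {T : Type u} [SmallCategory T] {a b c a' b' c' : T} (s : a' ⟶ b')
    (t : b' ⟶ c') (p : a = a') (q : b' = b) (q' : b = b') (r : c' = c) :
    (eqToHom p ≫ s ≫ eqToHom q) ≫ eqToHom q' ≫ t ≫ eqToHom r =
      eqToHom p ≫ (s ≫ t) ≫ eqToHom r := by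
  subst p q r
  simp

section

variable {n : ℕ} {C : Type u} [SmallCategory C] {y : Fin n → C}

namespace Separated

/-- An arrow from `x i` to an object of `C` is the edge `x i ⟶ y i` followed by an arrow of `C`. -/
inductive Hom : Separated y → Separated y → Type u
  | base {c d : C} (f : c ⟶ d) : Hom (base c) (base d)
  | toBase (i : Fin n) {d : C} (f : y i ⟶ d) : Hom (x i) (base d)
  | idX (i : Fin n) : Hom (x i) (x i)
  | toApex (i : Fin n) : Hom (x i) apex
  | idApex : Hom apex apex

/-- Composition of arrows. -/
def Hom.comp : {a b c : Separated y} → Hom a b → Hom b c → Hom a c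
  | _, _, _, .base f, .base g => .base (f ≫ g)
  | _, _, _, .toBase i f, .base g => .toBase i (f ≫ g)
  | _, _, _, .idX _, h => h
  | _, _, _, .toApex i, .idApex => .toApex i
  | _, _, _, .idApex, .idApex => .idApex

instance : SmallCategory (Separated y) where
  Hom := Hom
  id
    | base c => .base (𝟙 c)
    | x i => .idX i
    | apex => .idApex
  comp := Hom.comp
  id_comp f := by cases f <;> simp [Hom.comp]
  comp_id f := by cases f <;> simp [Hom.comp]
  assoc f g h := by cases f <;> cases g <;> cases h <;> simp [Hom.comp]

/-- The inclusion of `C`. -/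
def incl (y : Fin n → C) : C ⥤ Separated y where
  obj := base
  map f := Hom.base f
  map_id _ := rfl
  map_comp _ _ := rfl

/-- The edge `x i ⟶ y i`. -/
abbrev edge (i : Fin n) : (x i : Separated y) ⟶ base (y i) := Hom.toBase i (𝟙 _)

/-- The inclusion of the separated sink. -/
def sink (y : Fin n → C) : SepSink.{u} n ⥤ Separated y :=
  Paths.lift
    { obj := fun
        | .x i => x i
        | .y i => base (y i)
        | .v => apex
      map := fun
        | .toY i => edge i
        | .toV i => Hom.toApex i }

theorem hom_toBase (i : Fin n) {d : C} (f : y i ⟶ d) :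
    (Hom.toBase i f : (x i : Separated y) ⟶ base d) = edge i ≫ (incl y).map f :=
  congrArg (Hom.toBase i) (Category.id_comp f).symm

section Desc

variable {T : Type u} [SmallCategory T] (j : C ⥤ T) (t : SepSink.{u} n ⥤ T)
  (h : Pts.functor y ⋙ j = SepSink.targets n ⋙ t)

include h in
theorem desc_obj_eq (i : Fin n) :
    t.obj ((Paths.of (SepSinkVertex.{u} n)).obj (.y i)) = j.obj (y i) :=
  (Functor.congr_obj h (Pts.obj i)).symm

/-- The action on objects of `desc`. -/
def descObj : Separated y → T
  | base c => j.obj c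
  | x i => t.obj ((Paths.of (SepSinkVertex.{u} n)).obj (.x i))
  | apex => t.obj ((Paths.of (SepSinkVertex.{u} n)).obj .v)

/-- The action on arrows of `desc`. -/
def descMap : {a b : Separated y} → Hom a b → (descObj j t a ⟶ descObj j t b)
  | _, _, .base f => j.map f
  | _, _, .toBase i f => t.map (SepSink.edge i) ≫ eqToHom (desc_obj_eq j t h i) ≫ j.map f
  | _, _, .idX i => 𝟙 _
  | _, _, .toApex i => t.map ((Paths.of (SepSinkVertex.{u} n)).map (SepSinkArrow.toV i))
  | _, _, .idApex => 𝟙 _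

theorem descMap_comp {a b c : Separated y} (f : Hom a b) (g : Hom b c) :
    descMap j t h (f.comp g) = descMap j t h f ≫ descMap j t h g := by
  rcases f with f | ⟨i, f⟩ | i | i | _ <;> rcases g with g | ⟨k, g⟩ | k | k | _
  · exact j.map_comp f g
  · change t.map (SepSink.edge i) ≫ eqToHom (desc_obj_eq j t h i) ≫ j.map (f ≫ g) =
      (t.map (SepSink.edge i) ≫ eqToHom (desc_obj_eq j t h i) ≫ j.map f) ≫ j.map g
    simp only [Functor.map_comp, Category.assoc]
  · exact (Category.id_comp _).symm
  · exact (Category.id_comp _).symm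
  · exact (Category.id_comp _).symm
  · exact (Category.comp_id _).symm
  · exact (Category.id_comp _).symm

/-- The functor on `D⁺` induced by a functor on `C` and a functor on the separated sink. -/
def desc : Separated y ⥤ T where
  obj := descObj j t
  map := descMap j t h
  map_id a := by cases a <;> first | rfl | exact j.map_id _
  map_comp := descMap_comp j t h

theorem incl_desc : incl y ⋙ desc j t h = j := rfl

theorem sink_desc : sink y ⋙ desc j t h = t := by
  refine Paths.ext_functor ?_ ?_
  · funext a
    cases a
    · rfl
    · exact (desc_obj_eq j t h _).symm
    · rfl
  · rintro _ _ (i | i)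
    · have e : (sink y ⋙ desc j t h).map (SepSink.edge i) =
          t.map (SepSink.edge i) ≫ eqToHom (desc_obj_eq j t h i) := by
        change t.map (SepSink.edge i) ≫ eqToHom (desc_obj_eq j t h i) ≫ j.map (𝟙 _) = _
        simp
      exact e.trans (Category.id_comp _).symm
    · exact ((Category.id_comp _).trans (Category.comp_id _)).symm

end Desc

theorem functor_ext {T : Type u} [SmallCategory T] {F G : Separated y ⥤ T}
    (h₁ : incl y ⋙ F = incl y ⋙ G) (h₂ : sink y ⋙ F = sink y ⋙ G) : F = G := by
  have o (a) : F.obj a = G.obj a := by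
    rcases a with c | i | _
    · exact Functor.congr_obj h₁ c
    · exact Functor.congr_obj h₂ ((Paths.of (SepSinkVertex.{u} n)).obj (.x i))
    · exact Functor.congr_obj h₂ ((Paths.of (SepSinkVertex.{u} n)).obj .v)
  have he (i : Fin n) : F.map (edge i) =
      eqToHom (o _) ≫ G.map (edge (y := y) i) ≫ eqToHom (o _).symm :=
    Functor.congr_hom h₂ (SepSink.edge i)
  refine CategoryTheory.Functor.ext o ?_
  rintro _ _ (f | ⟨i, f⟩ | i | i | _)
  · exact Functor.congr_hom h₁ f
  · have hf : F.map ((incl y).map f) = eqToHom (o _) ≫ G.map ((incl y).map f) ≫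
        eqToHom (o _).symm := Functor.congr_hom h₁ f
    rw [hom_toBase]
    refine (F.map_comp _ _).trans ((congrArg₂ (fun a b => a ≫ b) (he i) hf).trans ?_)
    exact (eqToHom_conj_comp _ _ _ _ _ _).trans
      (congrArg (fun a => eqToHom _ ≫ a ≫ eqToHom _) (G.map_comp _ _)).symm
  · exact (F.map_id (x i)).trans (by erw [G.map_id (x i)]; simp)
  · exact Functor.congr_hom h₂ ((Paths.of (SepSinkVertex.{u} n)).map (SepSinkArrow.toV i))
  · exact (F.map_id apex).trans (by erw [G.map_id apex]; simp)

theorem incl_sink : Pts.functor y ⋙ incl y = SepSink.targets n ⋙ sink y :=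
  Discrete.functor_ext fun _ => rfl

/-- The explicit model is the pushout defining `D⁺`. -/
theorem isPushout (y : Fin n → C) :
    IsPushout (Pts.functor y).toCatHom (SepSink.targets.{u} n).toCatHom
      (incl y).toCatHom (sink y).toCatHom := by
  refine ⟨⟨Cat.ext incl_sink⟩, ⟨Limits.PushoutCocone.IsColimit.mk _
    (fun s => (desc (y := y) s.inl.toFunctor s.inr.toFunctor
      (congrArg Cat.Hom.toFunctor s.condition)).toCatHom) ?_ ?_ ?_⟩⟩
  · intro s; exact Cat.ext (incl_desc _ _ _)
  · intro s; exact Cat.ext (sink_desc _ _ _)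
  · intro s m h₁ h₂
    refine Cat.ext (functor_ext ?_ ?_)
    · exact congrArg Cat.Hom.toFunctor h₁
    · exact (congrArg Cat.Hom.toFunctor h₂).trans (sink_desc _ _ _).symm

end Separated

namespace Attached

/-- An arrow from an object of `C` to `apex` is an arrow of `C` to some `y i` followed by the arrow
`y i ⟶ apex`, in a unique way. -/
inductive Hom : Attached y → Attached y → Type u
  | base {c d : C} (f : c ⟶ d) : Hom (base c) (base d)
  | toApex (i : Fin n) {c : C} (f : c ⟶ y i) : Hom (base c) apex
  | idApex : Hom apex apex

/-- Composition of arrows. -/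
def Hom.comp : {a b c : Attached y} → Hom a b → Hom b c → Hom a c
  | _, _, _, .base f, .base g => .base (f ≫ g)
  | _, _, _, .base f, .toApex i g => .toApex i (f ≫ g)
  | _, _, _, .toApex i f, .idApex => .toApex i f
  | _, _, _, .idApex, .idApex => .idApex

instance : SmallCategory (Attached y) where
  Hom := Hom
  id
    | base c => .base (𝟙 c)
    | apex => .idApex
  comp := Hom.comp
  id_comp f := by cases f <;> simp [Hom.comp]
  comp_id f := by cases f <;> simp [Hom.comp]
  assoc f g h := by cases f <;> cases g <;> cases h <;> simp [Hom.comp]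

/-- The inclusion of `C`. -/
def incl (y : Fin n → C) : C ⥤ Attached y where
  obj := base
  map f := Hom.base f
  map_id _ := rfl
  map_comp _ _ := rfl

/-- The arrow `y i ⟶ apex`. -/
abbrev edge (i : Fin n) : (base (y i) : Attached y) ⟶ apex := Hom.toApex i (𝟙 _)

/-- The inclusion of the sink. -/
def sink (y : Fin n → C) : Sink.{u} n ⥤ Attached y :=
  WithTerminal.lift (Z := apex) (Pts.functor y ⋙ incl y) (fun i => edge i.as.down)
    (fun i j f => by
      obtain rfl := Discrete.ext (Discrete.eq_of_hom f)
      obtain rfl : f = 𝟙 _ := Subsingleton.elim _ _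
      exact (congrArg (fun g => g ≫ edge i.as.down)
        ((Pts.functor y ⋙ incl y).map_id i)).trans (Category.id_comp (edge i.as.down)))

theorem hom_toApex (i : Fin n) {c : C} (f : c ⟶ y i) :
    (Hom.toApex i f : (base c : Attached y) ⟶ apex) = (incl y).map f ≫ edge i :=
  congrArg (Hom.toApex i) (Category.comp_id f).symm

section Desc

variable {T : Type u} [SmallCategory T] (j : C ⥤ T) (t : Sink.{u} n ⥤ T)
  (h : Pts.functor y ⋙ j = (SepSink.targets.{u} n ⋙ SepSink.collapse.{u} n) ⋙ t)

include h in
theorem desc_obj_eq (i : Fin n) :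
    j.obj (y i) = t.obj (WithTerminal.incl.obj (Pts.obj i)) :=
  Functor.congr_obj h (Pts.obj i)

/-- The action on objects of `desc`. -/
def descObj : Attached y → T
  | base c => j.obj c
  | apex => t.obj WithTerminal.star

/-- The action on arrows of `desc`. -/
def descMap : {a b : Attached y} → Hom a b → (descObj j t a ⟶ descObj j t b)
  | _, _, .base f => j.map f
  | _, _, .toApex i f => j.map f ≫ eqToHom (desc_obj_eq j t h i) ≫
      t.map (WithTerminal.starTerminal.from (WithTerminal.incl.obj (Pts.obj i)))
  | _, _, .idApex => 𝟙 _

theorem descMap_comp {a b c : Attached y} (f : Hom a b) (g : Hom b c) :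
    descMap j t h (f.comp g) = descMap j t h f ≫ descMap j t h g := by
  rcases f with f | ⟨i, f⟩ | _ <;> rcases g with g | ⟨k, g⟩ | _
  · exact j.map_comp f g
  · exact (congrArg (fun a => a ≫ eqToHom (desc_obj_eq j t h k) ≫
      t.map (WithTerminal.starTerminal.from (WithTerminal.incl.obj (Pts.obj k))))
        (j.map_comp f g)).trans (Category.assoc _ _ _)
  · exact (Category.comp_id _).symm
  · exact (Category.comp_id _).symm

/-- The functor on `C⁺` induced by a functor on `C` and a functor on the sink. -/
def desc : Attached y ⥤ T where
  obj := descObj j t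
  map := descMap j t h
  map_id a := by cases a <;> first | rfl | exact j.map_id _
  map_comp := descMap_comp j t h

theorem incl_desc : incl y ⋙ desc j t h = j := rfl

theorem sink_desc : sink y ⋙ desc j t h = t := by
  have o (a) : (sink y ⋙ desc j t h).obj a = t.obj a := by
    rcases a with ⟨⟨⟨i⟩⟩⟩ | _
    · exact desc_obj_eq j t h i
    · rfl
  refine CategoryTheory.Functor.ext o ?_
  rintro (a | _) (b | _) f
  · obtain rfl : a = b := Discrete.ext (Discrete.eq_of_hom (WithTerminal.down f))
    obtain rfl : f = 𝟙 _ := Subsingleton.elim _ _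
    rw [CategoryTheory.Functor.map_id, CategoryTheory.Functor.map_id]
    simp
  · obtain rfl : f = WithTerminal.starTerminal.from (WithTerminal.incl.obj a) :=
      WithTerminal.starTerminal.hom_ext _ _
    obtain ⟨⟨i⟩⟩ := a
    have e : (sink y ⋙ desc j t h).map
        (WithTerminal.starTerminal.from (WithTerminal.incl.obj (Pts.obj i))) =
        j.map (𝟙 _) ≫ eqToHom (desc_obj_eq j t h i) ≫
          t.map (WithTerminal.starTerminal.from (WithTerminal.incl.obj (Pts.obj i))) := rfl
    refine e.trans ?_
    rw [j.map_id, Category.id_comp]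
    exact congrArg (fun a => eqToHom _ ≫ a) (Category.comp_id _).symm
  · exact (WithTerminal.false_of_from_star f).elim
  · obtain rfl : f = 𝟙 _ := Subsingleton.elim _ _
    rw [CategoryTheory.Functor.map_id, CategoryTheory.Functor.map_id]
    simp

end Desc

theorem functor_ext {T : Type u} [SmallCategory T] {F G : Attached y ⥤ T}
    (h₁ : incl y ⋙ F = incl y ⋙ G) (h₂ : sink y ⋙ F = sink y ⋙ G) : F = G := by
  have o (a) : F.obj a = G.obj a := by
    rcases a with c | _
    · exact Functor.congr_obj h₁ c
    · exact Functor.congr_obj h₂ WithTerminal.star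
  have he (i : Fin n) : F.map (edge i) =
      eqToHom (o _) ≫ G.map (edge (y := y) i) ≫ eqToHom (o _).symm :=
    Functor.congr_hom h₂ (WithTerminal.starTerminal.from (WithTerminal.incl.obj (Pts.obj i)))
  refine CategoryTheory.Functor.ext o ?_
  rintro _ _ (f | ⟨i, f⟩ | _)
  · exact Functor.congr_hom h₁ f
  · have hf : F.map ((incl y).map f) = eqToHom (o _) ≫ G.map ((incl y).map f) ≫
        eqToHom (o _).symm := Functor.congr_hom h₁ f
    rw [hom_toApex]
    refine (F.map_comp _ _).trans ((congrArg₂ (fun a b => a ≫ b) hf (he i)).trans ?_)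
    exact (eqToHom_conj_comp _ _ _ _ _ _).trans
      (congrArg (fun a => eqToHom _ ≫ a ≫ eqToHom _) (G.map_comp _ _)).symm
  · exact (F.map_id apex).trans (by erw [G.map_id apex]; simp)

theorem incl_sink :
    Pts.functor y ⋙ incl y = (SepSink.targets.{u} n ⋙ SepSink.collapse.{u} n) ⋙ sink y :=
  Discrete.functor_ext fun _ => rfl

/-- The explicit model is the pushout of `C` and the sink, which is `C⁺` by the pasting law. -/
theorem isPushout (y : Fin n → C) :
    IsPushout (Pts.functor y).toCatHom
      ((SepSink.targets.{u} n).toCatHom ≫ (SepSink.collapse.{u} n).toCatHom)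
      (incl y).toCatHom (sink y).toCatHom := by
  refine ⟨⟨Cat.ext incl_sink⟩, ⟨Limits.PushoutCocone.IsColimit.mk _
    (fun s => (desc (y := y) s.inl.toFunctor s.inr.toFunctor
      (congrArg Cat.Hom.toFunctor s.condition)).toCatHom) ?_ ?_ ?_⟩⟩
  · intro s; exact Cat.ext (incl_desc _ _ _)
  · intro s; exact Cat.ext (sink_desc _ _ _)
  · intro s m h₁ h₂
    refine Cat.ext (functor_ext ?_ ?_)
    · exact congrArg Cat.Hom.toFunctor h₁
    · exact (congrArg Cat.Hom.toFunctor h₂).trans (sink_desc _ _ _).symm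

end Attached

namespace Separated

/-- The action on objects of `contract`. -/
def contractObj : Separated y → Attached y
  | base c => .base c
  | x i => .base (y i)
  | apex => .apex

/-- The action on arrows of `contract`. -/
def contractMap : {a b : Separated y} → Hom a b → Attached.Hom (contractObj a) (contractObj b)
  | _, _, .base f => .base f
  | _, _, .toBase _ f => .base f
  | _, _, .idX _ => .base (𝟙 _)
  | _, _, .toApex i => .toApex i (𝟙 _)
  | _, _, .idApex => .idApex

/-- The functor `u⁺`, contracting the edges `x i ⟶ y i`. -/
def contract (y : Fin n → C) : Separated y ⥤ Attached y where
  obj := contractObj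
  map := contractMap
  map_id a := by cases a <;> rfl
  map_comp f g := by
    rcases f with f | ⟨i, f⟩ | i | i | _ <;> rcases g with g | ⟨k, g⟩ | k | k | _ <;>
      first | rfl | exact congrArg Attached.Hom.base (Category.id_comp _).symm |
        exact congrArg (Attached.Hom.toApex _) (Category.id_comp _).symm

theorem sink_contract : sink y ⋙ contract y = SepSink.collapse.{u} n ⋙ Attached.sink y := by
  refine Paths.ext_functor ?_ ?_
  · funext a
    cases a <;> rfl
  · rintro _ _ (i | i)
    · exact ((Category.id_comp _).trans (Category.comp_id _)).symm
    · exact ((Category.id_comp _).trans (Category.comp_id _)).symm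

/-- The edges `x i ⟶ y i`. -/
abbrev edges (y : Fin n → C) : MorphismProperty (Separated y) := SepSink.edges (sink y)

theorem edges_edge (i : Fin n) : edges y (edge i) :=
  ⟨i⟩

theorem edges_isInvertedBy : (edges y).IsInvertedBy (contract y) := by
  rintro _ _ _ ⟨i⟩
  exact inferInstanceAs (IsIso (𝟙 (Attached.base (y i))))

theorem contract_surjective : Function.Surjective (contract y).obj := by
  rintro (c | _)
  · exact ⟨base c, rfl⟩
  · exact ⟨apex, rfl⟩

end Separated

/-! ### The zigzags for the contraction of a separated sink -/

namespace Separated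

section Zigzag

variable (c : C)

/-- The object `(y i, c ⟶ y i)` of `(c / u⁺)` replacing `(x i, c ⟶ y i)` and
`(apex, c ⟶ y i ⟶ apex)`; the other objects are unchanged. -/
def toBaseObj : (d : Separated y) → Attached.Hom (.base c) (contractObj d) →
    StructuredArrow (Attached.base c) (contract y)
  | base d, .base h => StructuredArrow.mk (Y := base d) (Attached.Hom.base h)
  | x i, .base h => StructuredArrow.mk (Y := base (y i)) (Attached.Hom.base h)
  | apex, .toApex i h => StructuredArrow.mk (Y := base (y i)) (Attached.Hom.base h)

/-- The object `(x i, c ⟶ y i)` of `(c / u⁺)` replacing `(apex, c ⟶ y i ⟶ apex)`; the other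
objects are unchanged. -/
def toXObj : (d : Separated y) → Attached.Hom (.base c) (contractObj d) →
    StructuredArrow (Attached.base c) (contract y)
  | base d, .base h => StructuredArrow.mk (Y := base d) (Attached.Hom.base h)
  | x i, .base h => StructuredArrow.mk (Y := x i) (Attached.Hom.base h)
  | apex, .toApex i h => StructuredArrow.mk (Y := x i) (Attached.Hom.base h)

variable {c}

/-- The action on arrows of the functor with object function `toBaseObj`. -/
def toBaseMap : {d d' : Separated y} → (f : Hom d d') →
    (h : Attached.Hom (.base c) (contractObj d)) → (h' : Attached.Hom (.base c) (contractObj d')) →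
      h.comp (contractMap f) = h' → ((toBaseObj c d h).right ⟶ (toBaseObj c d' h').right)
  | _, _, .base f, .base _, .base _, _ => Hom.base f
  | _, _, .toBase _ f, .base _, .base _, _ => Hom.base f
  | _, _, .idX i, .base _, .base _, _ => Hom.base (𝟙 (y i))
  | _, _, .toApex _, .base _, .toApex _ _, w => Hom.base (eqToHom (by cases w; rfl))
  | _, _, .idApex, .toApex _ _, .toApex _ _, w => Hom.base (eqToHom (by cases w; rfl))

/-- The action on arrows of the functor with object function `toXObj`. -/
def toXMap : {d d' : Separated y} → (f : Hom d d') →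
    (h : Attached.Hom (.base c) (contractObj d)) → (h' : Attached.Hom (.base c) (contractObj d')) →
      h.comp (contractMap f) = h' → ((toXObj c d h).right ⟶ (toXObj c d' h').right)
  | _, _, .base f, .base _, .base _, _ => Hom.base f
  | _, _, .toBase i f, .base _, .base _, _ => Hom.toBase i f
  | _, _, .idX i, .base _, .base _, _ => Hom.idX i
  | _, _, .toApex i, .base _, .toApex k _, w => eqToHom (C := Separated y)
      (show x i = x k by cases w; rfl)
  | _, _, .idApex, .toApex i _, .toApex k _, w => eqToHom (C := Separated y)
      (show x i = x k by cases w; rfl)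

theorem toBaseMap_w {d d' : Separated y} (f : Hom d d')
    (h : Attached.Hom (.base c) (contractObj d)) (h' : Attached.Hom (.base c) (contractObj d'))
    (w : h.comp (contractMap f) = h') :
    (toBaseObj c d h).hom ≫ (contract y).map (toBaseMap f h h' w) = (toBaseObj c d' h').hom := by
  rcases f with f | ⟨i, f⟩ | i | i | _ <;> rcases h with h | ⟨k, h⟩ | _ <;>
    rcases h' with h' | ⟨k', h'⟩ | _
  · exact w
  · exact w
  · exact w
  · cases w
    rfl
  · cases w
    exact congrArg Attached.Hom.base (Category.comp_id h)

theorem toXMap_w {d d' : Separated y} (f : Hom d d')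
    (h : Attached.Hom (.base c) (contractObj d)) (h' : Attached.Hom (.base c) (contractObj d'))
    (w : h.comp (contractMap f) = h') :
    (toXObj c d h).hom ≫ (contract y).map (toXMap f h h' w) = (toXObj c d' h').hom := by
  rcases f with f | ⟨i, f⟩ | i | i | _ <;> rcases h with h | ⟨k, h⟩ | _ <;>
    rcases h' with h' | ⟨k', h'⟩ | _
  · exact w
  · exact w
  · exact w
  · cases w
    rfl
  · cases w
    exact congrArg Attached.Hom.base (Category.comp_id h)

theorem toBaseMap_comp {d d' d'' : Separated y} (f : Hom d d') (g : Hom d' d'')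
    (h : Attached.Hom (.base c) (contractObj d)) (h' : Attached.Hom (.base c) (contractObj d'))
    (h'' : Attached.Hom (.base c) (contractObj d'')) (w : h.comp (contractMap f) = h')
    (w' : h'.comp (contractMap g) = h'') (w'' : h.comp (contractMap (f.comp g)) = h'') :
    toBaseMap (f.comp g) h h'' w'' = toBaseMap f h h' w ≫ toBaseMap g h' h'' w' := by
  rcases f with f | ⟨i, f⟩ | i | i | _ <;> rcases g with g | ⟨j, g⟩ | j | j | _ <;>
    rcases h with h | ⟨k, h⟩ | _ <;> rcases h' with h' | ⟨k', h'⟩ | _ <;>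
      rcases h'' with h'' | ⟨k'', h''⟩ | _
  · rfl
  · rfl
  · exact congrArg Hom.base (Category.id_comp g).symm
  · exact congrArg Hom.base (Category.id_comp _).symm
  · cases w'
    exact congrArg Hom.base (Category.id_comp _).symm
  · cases w
    cases w'
    exact congrArg Hom.base (Category.id_comp _).symm
  · cases w
    cases w'
    exact congrArg Hom.base (Category.id_comp _).symm

theorem toXMap_comp {d d' d'' : Separated y} (f : Hom d d') (g : Hom d' d'')
    (h : Attached.Hom (.base c) (contractObj d)) (h' : Attached.Hom (.base c) (contractObj d'))
    (h'' : Attached.Hom (.base c) (contractObj d'')) (w : h.comp (contractMap f) = h')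
    (w' : h'.comp (contractMap g) = h'') (w'' : h.comp (contractMap (f.comp g)) = h'') :
    toXMap (f.comp g) h h'' w'' = toXMap f h h' w ≫ toXMap g h' h'' w' := by
  rcases f with f | ⟨i, f⟩ | i | i | _ <;> rcases g with g | ⟨j, g⟩ | j | j | _ <;>
    rcases h with h | ⟨k, h⟩ | _ <;> rcases h' with h' | ⟨k', h'⟩ | _ <;>
      rcases h'' with h'' | ⟨k'', h''⟩ | _
  · rfl
  · rfl
  · rfl
  · rfl
  · cases w'
    rfl
  · cases w
    cases w'
    rfl
  · cases w
    cases w'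
    rfl

theorem toBaseMap_id (d : Separated y) (h : Attached.Hom (.base c) (contractObj d))
    (w : h.comp (contractMap (𝟙 d : d ⟶ d)) = h) : toBaseMap (𝟙 d : d ⟶ d) h h w = 𝟙 _ := by
  rcases d with d | i | _ <;> rcases h with h | ⟨k, h⟩ | _ <;> rfl

theorem toXMap_id (d : Separated y) (h : Attached.Hom (.base c) (contractObj d))
    (w : h.comp (contractMap (𝟙 d : d ⟶ d)) = h) : toXMap (𝟙 d : d ⟶ d) h h w = 𝟙 _ := by
  rcases d with d | i | _ <;> rcases h with h | ⟨k, h⟩ | _ <;> rfl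

variable (y c)

/-- The endofunctor of `(c / u⁺)` replacing `(x i, c ⟶ y i)` and `(apex, c ⟶ y i ⟶ apex)` by
`(y i, c ⟶ y i)`. -/
def toBase : StructuredArrow (Attached.base c) (contract y) ⥤
    StructuredArrow (Attached.base c) (contract y) where
  obj j := toBaseObj c j.right j.hom
  map φ := StructuredArrow.homMk (toBaseMap φ.right _ _ (StructuredArrow.w φ)) (toBaseMap_w _ _ _ _)
  map_id _ := StructuredArrow.hom_ext _ _ (toBaseMap_id _ _ _)
  map_comp _ _ := StructuredArrow.hom_ext _ _ (toBaseMap_comp _ _ _ _ _ _ _ _)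

/-- The endofunctor of `(c / u⁺)` replacing `(apex, c ⟶ y i ⟶ apex)` by `(x i, c ⟶ y i)`. -/
def toX : StructuredArrow (Attached.base c) (contract y) ⥤
    StructuredArrow (Attached.base c) (contract y) where
  obj j := toXObj c j.right j.hom
  map φ := StructuredArrow.homMk (toXMap φ.right _ _ (StructuredArrow.w φ)) (toXMap_w _ _ _ _)
  map_id _ := StructuredArrow.hom_ext _ _ (toXMap_id _ _ _)
  map_comp _ _ := StructuredArrow.hom_ext _ _ (toXMap_comp _ _ _ _ _ _ _ _)

variable {y c}

/-- The component at `(d, h)` of `const (c, 𝟙 c) ⟶ toBase`. -/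
def constToBaseApp : (d : Separated y) → (h : Attached.Hom (.base c) (contractObj d)) →
    ((base c : Separated y) ⟶ (toBaseObj c d h).right)
  | base _, .base h => Hom.base h
  | x _, .base h => Hom.base h
  | apex, .toApex _ h => Hom.base h

/-- The component at `(d, h)` of `toX ⟶ toBase`: the edge `x i ⟶ y i` or an identity. -/
def toXToBaseApp : (d : Separated y) → (h : Attached.Hom (.base c) (contractObj d)) →
    ((toXObj c d h).right ⟶ (toBaseObj c d h).right)
  | base d, .base _ => Hom.base (𝟙 d)
  | x i, .base _ => edge i
  | apex, .toApex i _ => edge i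

/-- The component at `(d, h)` of `toX ⟶ 𝟭`: the arrow `x i ⟶ apex` or an identity. -/
def toXToIdApp : (d : Separated y) → (h : Attached.Hom (.base c) (contractObj d)) →
    ((toXObj c d h).right ⟶ d)
  | base d, .base _ => Hom.base (𝟙 d)
  | x i, .base _ => Hom.idX i
  | apex, .toApex i _ => Hom.toApex i

theorem constToBaseApp_w (d : Separated y) (h : Attached.Hom (.base c) (contractObj d)) :
    Attached.Hom.base (𝟙 c) ≫ (contract y).map (constToBaseApp d h) = (toBaseObj c d h).hom := by
  rcases d with d | i | _ <;> rcases h with h | ⟨k, h⟩ | _ <;>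
    exact congrArg Attached.Hom.base (Category.id_comp h)

theorem toXToBaseApp_w (d : Separated y) (h : Attached.Hom (.base c) (contractObj d)) :
    (toXObj c d h).hom ≫ (contract y).map (toXToBaseApp d h) = (toBaseObj c d h).hom := by
  rcases d with d | i | _ <;> rcases h with h | ⟨k, h⟩ | _ <;>
    exact congrArg Attached.Hom.base (Category.comp_id h)

theorem toXToIdApp_w (d : Separated y) (h : Attached.Hom (.base c) (contractObj d)) :
    (toXObj c d h).hom ≫ (contract y).map (toXToIdApp d h) = h := by
  rcases d with d | i | _ <;> rcases h with h | ⟨k, h⟩ | _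
  · exact congrArg Attached.Hom.base (Category.comp_id h)
  · exact congrArg Attached.Hom.base (Category.comp_id h)
  · exact congrArg (Attached.Hom.toApex k) (Category.comp_id h)

theorem constToBaseApp_naturality {d d' : Separated y} (f : Hom d d')
    (h : Attached.Hom (.base c) (contractObj d)) (h' : Attached.Hom (.base c) (contractObj d'))
    (w : h.comp (contractMap f) = h') :
    constToBaseApp d' h' = constToBaseApp d h ≫ toBaseMap f h h' w := by
  rcases f with f | ⟨i, f⟩ | i | i | _ <;> rcases h with h | ⟨k, h⟩ | _ <;>
    rcases h' with h' | ⟨k', h'⟩ | _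
  · cases w; rfl
  · cases w; rfl
  · cases w; rfl
  · cases w; rfl
  · cases w
    exact congrArg Hom.base (Category.comp_id _).symm

theorem toXToBaseApp_naturality {d d' : Separated y} (f : Hom d d')
    (h : Attached.Hom (.base c) (contractObj d)) (h' : Attached.Hom (.base c) (contractObj d'))
    (w : h.comp (contractMap f) = h') :
    toXMap f h h' w ≫ toXToBaseApp d' h' = toXToBaseApp d h ≫ toBaseMap f h h' w := by
  rcases f with f | ⟨i, f⟩ | i | i | _ <;> rcases h with h | ⟨k, h⟩ | _ <;>
    rcases h' with h' | ⟨k', h'⟩ | _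
  · exact congrArg Hom.base ((Category.comp_id f).trans (Category.id_comp f).symm)
  · exact congrArg (Hom.toBase i) ((Category.comp_id f).trans (Category.id_comp f).symm)
  · exact congrArg (Hom.toBase i) (Category.comp_id (𝟙 (y i))).symm
  · cases w
    exact congrArg (Hom.toBase i) (Category.comp_id (𝟙 (y i))).symm
  · cases w
    exact congrArg (Hom.toBase k) (Category.comp_id (𝟙 (y k))).symm

theorem toXToIdApp_naturality {d d' : Separated y} (f : Hom d d')
    (h : Attached.Hom (.base c) (contractObj d)) (h' : Attached.Hom (.base c) (contractObj d'))
    (w : h.comp (contractMap f) = h') :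
    toXMap f h h' w ≫ toXToIdApp d' h' = toXToIdApp d h ≫ f := by
  rcases f with f | ⟨i, f⟩ | i | i | _ <;> rcases h with h | ⟨k, h⟩ | _ <;>
    rcases h' with h' | ⟨k', h'⟩ | _
  · exact congrArg Hom.base ((Category.comp_id f).trans (Category.id_comp f).symm)
  · exact congrArg (Hom.toBase i) (Category.comp_id f)
  · rfl
  · cases w; rfl
  · cases w; rfl

/-- The zigzag `const (c, 𝟙 c) ⟶ toBase ⟵ toX ⟶ 𝟭` in `(c / u⁺)`. -/
theorem hasZigzag_base (c : C) : PDer.HasZigzag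
    (StructuredArrow.proj ((contract y).obj (base c)) (contract y)) (edges y)
      (StructuredArrow.mk (𝟙 ((contract y).obj (base c)))) := by
  refine ⟨toBase y c, toX y c,
    { app j := StructuredArrow.homMk (constToBaseApp j.right j.hom) (constToBaseApp_w _ _)
      naturality i j φ := StructuredArrow.hom_ext _ _ ((Category.id_comp _).trans
        (constToBaseApp_naturality φ.right i.hom j.hom (StructuredArrow.w φ))) },
    { app j := StructuredArrow.homMk (toXToBaseApp j.right j.hom) (toXToBaseApp_w _ _)
      naturality i j φ := StructuredArrow.hom_ext _ _
        (toXToBaseApp_naturality φ.right i.hom j.hom (StructuredArrow.w φ)) },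
    { app j := StructuredArrow.homMk (toXToIdApp j.right j.hom) (toXToIdApp_w _ _)
      naturality i j φ := StructuredArrow.hom_ext _ _
        (toXToIdApp_naturality φ.right i.hom j.hom (StructuredArrow.w φ)) }, ?_, ?_, ?_⟩
  · exact inferInstanceAs (IsIso (𝟙 (StructuredArrow.mk (𝟙 ((contract y).obj (base c))))))
  · exact inferInstanceAs (IsIso (𝟙 (StructuredArrow.mk (𝟙 ((contract y).obj (base c))))))
  · rintro ⟨⟨⟨⟩⟩, d, h⟩
    change edges y (toXToBaseApp d h) ∨ IsIso (toXToBaseApp d h)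
    rcases d with d | i | _ <;> rcases h with h | ⟨k, h⟩ | _
    · exact Or.inr (inferInstanceAs (IsIso (𝟙 (base d : Separated y))))
    · exact Or.inl (edges_edge i)
    · exact Or.inl (edges_edge k)

/-- Only `apex` lies over `apex`, so that `(apex / u⁺)` is the terminal category. -/
theorem hasZigzag_apex : PDer.HasZigzag
    (StructuredArrow.proj ((contract y).obj apex) (contract y)) (edges y)
      (StructuredArrow.mk (𝟙 ((contract y).obj apex))) := by
  let J := StructuredArrow ((contract y).obj apex) (contract y)
  let j₀ : J := StructuredArrow.mk (𝟙 ((contract y).obj apex))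
  have hJ (j : J) : j₀ = j := by
    obtain ⟨⟨⟨⟩⟩, d, h⟩ := j
    change Attached.Hom .apex (contractObj d) at h
    rcases d with d | i | _ <;> cases h
    rfl
  have hh {i j : J} (φ ψ : i ⟶ j) : φ = ψ := by
    obtain rfl := hJ i
    obtain rfl := hJ j
    refine StructuredArrow.hom_ext _ _ ?_
    have (f : Hom (apex : Separated y) apex) : f = .idApex := by cases f; rfl
    exact (this φ.right).trans (this ψ.right).symm
  exact ⟨𝟭 _, 𝟭 _, { app j := eqToHom (hJ j), naturality _ _ _ := hh _ _ }, 𝟙 _, 𝟙 _,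
    by dsimp; infer_instance, inferInstance,
    fun j => Or.inr (inferInstanceAs (IsIso (𝟙 j.right)))⟩

/-- For the objects `x i`, the edge to `y i` reduces to the zigzag at `y i`. -/
theorem exists_hasZigzag (d : Separated y) : ∃ (d' : Separated y) (g : d ⟶ d'),
    (edges y g ∨ IsIso g) ∧ PDer.HasZigzag
      (StructuredArrow.proj ((contract y).obj d') (contract y)) (edges y)
        (StructuredArrow.mk (𝟙 ((contract y).obj d'))) := by
  rcases d with c | i | _
  · exact ⟨base c, 𝟙 _, Or.inr inferInstance, hasZigzag_base c⟩
  · exact ⟨base (y i), edge i, Or.inl (edges_edge i), hasZigzag_base (y i)⟩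
  · exact ⟨apex, 𝟙 _, Or.inr inferInstance, hasZigzag_apex⟩

end Zigzag

theorem isHomotopicalLocalization_contract :
    IsHomotopicalLocalization.{u, v, w} (contract y) (edges y) :=
  .of_zigzag contract_surjective edges_isInvertedBy exists_hasZigzag

theorem isHomotopicalLocalization_contract_prod (A : Type u) [SmallCategory A] :
    IsHomotopicalLocalization.{u, v, w} ((contract y).prod (𝟭 A)) ((edges y).prodIsos A) := by
  refine .of_zigzag ?_ (MorphismProperty.prodIsos_isInvertedBy edges_isInvertedBy A) ?_
  · rintro ⟨b, a⟩
    obtain ⟨d, rfl⟩ := contract_surjective b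
    exact ⟨(d, a), rfl⟩
  · rintro ⟨d, a⟩
    obtain ⟨d', g, hg, hz⟩ := exists_hasZigzag d
    refine ⟨(d', a), Prod.mkHom g (𝟙 a), ?_, hz.prod a⟩
    rcases hg with hg | hg
    · exact Or.inl ⟨hg, inferInstanceAs (IsIso (𝟙 a))⟩
    · refine Or.inr ?_
      rw [isIso_prod_iff]
      exact ⟨hg, inferInstanceAs (IsIso (𝟙 a))⟩

end Separated

end

/-! ### Equivalences of pseudofunctors with values in categories -/

namespace PseudoEquiv

variable {B : Type u₂} [Bicategory.{w₂, v₂} B] {F G : B ⥤ᵖ Cat.{v, w}} (η : F ⟶ G)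
  [∀ b, (η.app b).toFunctor.IsEquivalence]

/-- The component at `b` of `η`, as an equivalence of categories. -/
abbrev eqv (b : B) : CategoryTheory.Equivalence (F.obj b) (G.obj b) := (η.app b).toFunctor.asEquivalence

/-- The coherence isomorphism of `η` at `f`, evaluated at `X`. -/
abbrev nat {b c : B} (f : b ⟶ c) (X : F.obj b) :
    (eqv η c).functor.obj ((F.map f).toFunctor.obj X) ≅
      (G.map f).toFunctor.obj ((eqv η b).functor.obj X) :=
  (Cat.Hom.toNatIso (η.naturality f)).app X

/-- The coherence isomorphism of the inverse transformation, characterized by its image under the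
component of `η`. -/
def invNat {b c : B} (f : b ⟶ c) (Y : G.obj b) :
    (eqv η c).inverse.obj ((G.map f).toFunctor.obj Y) ≅
      (F.map f).toFunctor.obj ((eqv η b).inverse.obj Y) :=
  (eqv η c).functor.preimageIso
    ((eqv η c).counitIso.app ((G.map f).toFunctor.obj Y) ≪≫
      (G.map f).toFunctor.mapIso ((eqv η b).counitIso.app Y).symm ≪≫
        (nat η f ((eqv η b).inverse.obj Y)).symm)

theorem map_invNat_hom {b c : B} (f : b ⟶ c) (Y : G.obj b) :
    (eqv η c).functor.map (invNat η f Y).hom =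
      (eqv η c).counit.app ((G.map f).toFunctor.obj Y) ≫
        (G.map f).toFunctor.map ((eqv η b).counitInv.app Y) ≫
          (nat η f ((eqv η b).inverse.obj Y)).inv :=
  (eqv η c).functor.map_preimage _

theorem nat_naturality {b c : B} (f : b ⟶ c) {X Y : F.obj b} (g : X ⟶ Y) :
    (eqv η c).functor.map ((F.map f).toFunctor.map g) ≫ (nat η f Y).hom =
      (nat η f X).hom ≫ (G.map f).toFunctor.map ((eqv η b).functor.map g) :=
  (Cat.Hom.toNatIso (η.naturality f)).hom.naturality g

theorem nat_inv_naturality {b c : B} (f : b ⟶ c) {X Y : F.obj b} (g : X ⟶ Y) :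
    (nat η f X).inv ≫ (eqv η c).functor.map ((F.map f).toFunctor.map g)  =
      (G.map f).toFunctor.map ((eqv η b).functor.map g) ≫ (nat η f Y).inv := by
  rw [Iso.inv_comp_eq, ← Category.assoc, Iso.eq_comp_inv, nat_naturality]

theorem counit_naturality {b : B} {X Y : G.obj b} (g : X ⟶ Y) :
    (eqv η b).functor.map ((eqv η b).inverse.map g) ≫ (eqv η b).counit.app Y =
      (eqv η b).counit.app X ≫ g :=
  (eqv η b).counit.naturality g

theorem counit_naturality_assoc {b : B} {X Y Z : G.obj b} (g : X ⟶ Y) (h : Y ⟶ Z) :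
    (eqv η b).functor.map ((eqv η b).inverse.map g) ≫ (eqv η b).counit.app Y ≫ h =
      (eqv η b).counit.app X ≫ g ≫ h := by
  rw [← Category.assoc]
  exact (congrArg (fun t => t ≫ h) (counit_naturality η g)).trans (Category.assoc _ _ _)

theorem counitInv_naturality {b : B} {X Y : G.obj b} (g : X ⟶ Y) :
    (eqv η b).counitInv.app X ≫ (eqv η b).functor.map ((eqv η b).inverse.map g) =
      g ≫ (eqv η b).counitInv.app Y :=
  ((eqv η b).counitInv.naturality g).symm

theorem invNat_naturality {b c : B} (f : b ⟶ c) {X Y : G.obj b} (g : X ⟶ Y) :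
    (eqv η c).inverse.map ((G.map f).toFunctor.map g) ≫ (invNat η f Y).hom =
      (invNat η f X).hom ≫ (F.map f).toFunctor.map ((eqv η b).inverse.map g) := by
  apply (eqv η c).functor.map_injective
  rw [Functor.map_comp, Functor.map_comp, map_invNat_hom, map_invNat_hom, Category.assoc,
    Category.assoc, nat_inv_naturality, counit_naturality_assoc, ← Functor.map_comp_assoc,
    ← Functor.map_comp_assoc, counitInv_naturality]

/-- The pseudo-natural transformation inverse to `η`. -/
def inv : G ⟶ F where
  app b := Cat.Hom.ofFunctor (eqv η b).inverse
  naturality f := Cat.Hom.isoMk (NatIso.ofComponents (invNat η f) (invNat_naturality η f))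
  naturality_naturality {b c f g} α := by
    ext Y
    change (eqv η c).inverse.map ((G.map₂ α).toNatTrans.app Y) ≫ (invNat η g Y).hom =
      (invNat η f Y).hom ≫ (F.map₂ α).toNatTrans.app ((eqv η b).inverse.obj Y)
    apply (eqv η c).functor.map_injective
    have h : (eqv η c).functor.map ((F.map₂ α).toNatTrans.app ((eqv η b).inverse.obj Y)) ≫
        (nat η g _).hom = (nat η f _).hom ≫ (G.map₂ α).toNatTrans.app _ :=
      congrArg (fun t => t.toNatTrans.app ((eqv η b).inverse.obj Y)) (η.naturality_naturality α)
    have h' := (G.map₂ α).toNatTrans.naturality ((eqv η b).counitInv.app Y)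
    rw [Functor.map_comp, Functor.map_comp, map_invNat_hom, map_invNat_hom,
      counit_naturality_assoc, ← cancel_mono (nat η g ((eqv η b).inverse.obj Y)).hom]
    simp only [Category.assoc, Iso.inv_hom_id, h, Iso.inv_hom_id_assoc]
    rw [Category.comp_id]
    exact congrArg (fun t => (eqv η c).counit.app _ ≫ t) h'.symm
  naturality_id b := by
    ext Y
    have h : (nat η (𝟙 b) ((eqv η b).inverse.obj Y)).hom ≫ (G.mapId b).hom.toNatTrans.app _ =
        (eqv η b).functor.map ((F.mapId b).hom.toNatTrans.app ((eqv η b).inverse.obj Y)) ≫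
          𝟙 _ ≫ 𝟙 _ :=
      congrArg (fun t => t.toNatTrans.app ((eqv η b).inverse.obj Y)) (η.naturality_id b)
    have h' := (G.mapId b).hom.toNatTrans.naturality ((eqv η b).counitInv.app Y)
    suffices e : (invNat η (𝟙 b) Y).hom ≫
        (F.mapId b).hom.toNatTrans.app ((eqv η b).inverse.obj Y) =
        (eqv η b).inverse.map ((G.mapId b).hom.toNatTrans.app Y) by
      refine Eq.trans e ?_
      exact (by simp : (eqv η b).inverse.map ((G.mapId b).hom.toNatTrans.app Y) =
        (eqv η b).inverse.map ((G.mapId b).hom.toNatTrans.app Y) ≫ 𝟙 _ ≫ 𝟙 _)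
    apply (eqv η b).functor.map_injective
    rw [Category.comp_id, Category.comp_id] at h
    rw [Functor.map_comp, map_invNat_hom, ← h, Category.assoc, Category.assoc,
      Iso.inv_hom_id_assoc]
    refine (congrArg (fun t => (eqv η b).counit.app _ ≫ t) h').trans ?_
    refine (counit_naturality_assoc η ((G.mapId b).hom.toNatTrans.app Y) _).symm.trans ?_
    refine (congrArg (fun t => _ ≫ t) ((eqv η b).counitIso.hom_inv_id_app Y)).trans ?_
    exact Category.comp_id _
  naturality_comp {a b c} f g := by
    ext Y
    have h : (nat η (f ≫ g) ((eqv η a).inverse.obj Y)).hom ≫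
        (G.mapComp f g).hom.toNatTrans.app _ =
        (eqv η c).functor.map ((F.mapComp f g).hom.toNatTrans.app ((eqv η a).inverse.obj Y)) ≫
          𝟙 _ ≫ (nat η g _).hom ≫ 𝟙 _ ≫ (G.map g).toFunctor.map (nat η f _).hom ≫ 𝟙 _ :=
      congrArg (fun t => t.toNatTrans.app ((eqv η a).inverse.obj Y)) (η.naturality_comp f g)
    have h' := (G.mapComp f g).hom.toNatTrans.naturality ((eqv η a).counitInv.app Y)
    suffices e : (invNat η (f ≫ g) Y).hom ≫
        (F.mapComp f g).hom.toNatTrans.app ((eqv η a).inverse.obj Y) =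
        (eqv η c).inverse.map ((G.mapComp f g).hom.toNatTrans.app Y) ≫
          (invNat η g _).hom ≫ (F.map g).toFunctor.map (invNat η f Y).hom by
      refine Eq.trans e ?_
      exact (by simp : (eqv η c).inverse.map ((G.mapComp f g).hom.toNatTrans.app Y) ≫
          (invNat η g _).hom ≫ (F.map g).toFunctor.map (invNat η f Y).hom =
        (eqv η c).inverse.map ((G.mapComp f g).hom.toNatTrans.app Y) ≫
          𝟙 _ ≫ (invNat η g _).hom ≫ 𝟙 _ ≫ (F.map g).toFunctor.map (invNat η f Y).hom ≫ 𝟙 _)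
    apply (eqv η c).functor.map_injective
    rw [Category.id_comp, Category.id_comp, Category.comp_id] at h
    have h₁ := nat_inv_naturality η g (invNat η f Y).hom
    rw [map_invNat_hom] at h₁
    rw [Functor.map_comp, Functor.map_comp, Functor.map_comp, map_invNat_hom, map_invNat_hom,
      Category.assoc, Category.assoc, Category.assoc, Category.assoc, h₁]
    refine Eq.trans ?_ (counit_naturality_assoc η ((G.mapComp f g).hom.toNatTrans.app Y) _).symm
    refine congrArg (fun t => (eqv η c).counit.app _ ≫ t) ?_
    have h₂ : (nat η (f ≫ g) ((eqv η a).inverse.obj Y)).inv ≫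
        (eqv η c).functor.map ((F.mapComp f g).hom.toNatTrans.app ((eqv η a).inverse.obj Y)) =
        (G.mapComp f g).hom.toNatTrans.app _ ≫
          (G.map g).toFunctor.map (nat η f ((eqv η a).inverse.obj Y)).inv ≫
            (nat η g ((F.map f).toFunctor.obj ((eqv η a).inverse.obj Y))).inv := by
      rw [Iso.inv_comp_eq, reassoc_of% h]
      refine Eq.symm ((congrArg (fun t => _ ≫ _ ≫ t) ?_).trans
        ((congrArg (fun t => _ ≫ t) (Iso.hom_inv_id _)).trans (Category.comp_id _)))
      rw [← Functor.map_comp_assoc, Iso.hom_inv_id, CategoryTheory.Functor.map_id,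
        Category.id_comp]
    have h₃ : (G.map g).toFunctor.map ((eqv η b).counitInv.app ((G.map f).toFunctor.obj Y)) ≫
          (G.map g).toFunctor.map
              ((eqv η b).counit.app ((G.map f).toFunctor.obj Y) ≫
                (G.map f).toFunctor.map ((eqv η a).counitInv.app Y) ≫
                  (nat η f ((eqv η a).inverse.obj Y)).inv) ≫
            (nat η g ((F.map f).toFunctor.obj ((eqv η a).inverse.obj Y))).inv =
        (G.map g).toFunctor.map ((G.map f).toFunctor.map ((eqv η a).counitInv.app Y)) ≫
          (G.map g).toFunctor.map (nat η f ((eqv η a).inverse.obj Y)).inv ≫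
            (nat η g ((F.map f).toFunctor.obj ((eqv η a).inverse.obj Y))).inv := by
      rw [← Functor.map_comp_assoc, ← Functor.map_comp_assoc]
      refine congrArg (fun t => (G.map g).toFunctor.map t ≫ _) ?_
      exact (Category.assoc _ _ _).symm.trans
        ((congrArg (fun t => t ≫ _) ((eqv η b).counitIso.inv_hom_id_app _)).trans
          (Category.id_comp _))
    rw [h₂, h₃]
    refine (Category.assoc _ _ _).symm.trans ((congrArg (fun t => t ≫ _) h').trans ?_)
    exact Category.assoc _ _ _

/-- The unit `𝟙 ≅ η ≫ η⁻¹`. -/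
def unitIso : 𝟙 F ≅ η ≫ inv η :=
  PseudoWhisker.isoMk (fun b => Cat.Hom.isoMk (eqv η b).unitIso) (fun {b c} f => by
    ext X
    have h : ((η ≫ inv η).naturality f).hom.toNatTrans.app X =
        (eqv η c).inverse.map (nat η f X).hom ≫ (invNat η f ((eqv η b).functor.obj X)).hom := by
      refine (congrArg (fun t => t.toNatTrans.app X)
        (Pseudofunctor.StrongTrans.categoryStruct_comp_naturality_hom η (inv η) f)).trans ?_
      exact (by simp : 𝟙 _ ≫ (eqv η c).inverse.map (nat η f X).hom ≫ 𝟙 _ ≫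
        (invNat η f ((eqv η b).functor.obj X)).hom ≫ 𝟙 _ =
        (eqv η c).inverse.map (nat η f X).hom ≫ (invNat η f ((eqv η b).functor.obj X)).hom)
    suffices e : (eqv η c).unit.app ((F.map f).toFunctor.obj X) ≫
        (eqv η c).inverse.map (nat η f X).hom ≫ (invNat η f ((eqv η b).functor.obj X)).hom =
        (F.map f).toFunctor.map ((eqv η b).unit.app X) by
      refine (congrArg (fun t => (eqv η c).unit.app ((F.map f).toFunctor.obj X) ≫ t) h).trans
        (e.trans ?_)
      exact (by simp : (F.map f).toFunctor.map ((eqv η b).unit.app X) =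
        (𝟙 _ ≫ 𝟙 _) ≫ (F.map f).toFunctor.map ((eqv η b).unit.app X))
    apply (eqv η c).functor.map_injective
    rw [Functor.map_comp, Functor.map_comp, map_invNat_hom, counit_naturality_assoc,
      CategoryTheory.Equivalence.counitInv_app_functor]
    refine (Category.assoc _ _ _).symm.trans ((congrArg (fun t => t ≫ _)
      ((eqv η c).functor_unit_comp _)).trans ((Category.id_comp _).trans ?_))
    rw [← Category.assoc, Iso.comp_inv_eq]
    exact (nat_naturality η f ((eqv η b).unit.app X)).symm)

/-- The counit `η⁻¹ ≫ η ≅ 𝟙`. -/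
def counitIso : inv η ≫ η ≅ 𝟙 G :=
  PseudoWhisker.isoMk (fun b => Cat.Hom.isoMk (eqv η b).counitIso) (fun {b c} f => by
    ext Y
    have h : ((inv η ≫ η).naturality f).hom.toNatTrans.app Y =
        (eqv η c).functor.map (invNat η f Y).hom ≫
          (nat η f ((eqv η b).inverse.obj Y)).hom := by
      refine (congrArg (fun t => t.toNatTrans.app Y)
        (Pseudofunctor.StrongTrans.categoryStruct_comp_naturality_hom (inv η) η f)).trans ?_
      exact (Category.id_comp _).trans (congrArg
        (fun t => (eqv η c).functor.map (invNat η f Y).hom ≫ t)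
        ((Category.id_comp _).trans (Category.comp_id _)))
    suffices e : (eqv η c).counit.app ((G.map f).toFunctor.obj Y) =
        ((eqv η c).functor.map (invNat η f Y).hom ≫
          (nat η f ((eqv η b).inverse.obj Y)).hom) ≫
            (G.map f).toFunctor.map ((eqv η b).counit.app Y) by
      refine Eq.trans ?_ (e.trans (congrArg
        (fun t => t ≫ (G.map f).toFunctor.map ((eqv η b).counit.app Y)) h.symm))
      exact (by simp : (eqv η c).counit.app ((G.map f).toFunctor.obj Y) ≫ 𝟙 _ ≫ 𝟙 _ =
        (eqv η c).counit.app ((G.map f).toFunctor.obj Y))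
    rw [map_invNat_hom, Category.assoc, Category.assoc, Category.assoc, Iso.inv_hom_id_assoc]
    refine Eq.symm ((congrArg (fun t => _ ≫ t) ?_).trans (Category.comp_id _))
    rw [← Functor.map_comp]
    exact (congrArg _ ((eqv η b).counitIso.inv_hom_id_app Y)).trans
      (CategoryTheory.Functor.map_id _ _))

/-- A pseudo-natural transformation between pseudofunctors to `Cat` whose components are
equivalences of categories is an equivalence. -/
def equivalence : Bicategory.Equivalence F G :=
  .mkOfAdjointifyCounit (unitIso η) (counitIso η)

end PseudoEquiv

/-! ### Functors out of pushouts of small categories -/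

namespace CategoryTheory.IsPushout

variable {P A B D T : Type u} [SmallCategory P] [SmallCategory A] [SmallCategory B]
  [SmallCategory D] [SmallCategory T] {f : P ⥤ A} {g : P ⥤ B} {j : A ⥤ D} {t : B ⥤ D}

theorem functor_ext (h : IsPushout f.toCatHom g.toCatHom j.toCatHom t.toCatHom) {F G : D ⥤ T}
    (h₁ : j ⋙ F = j ⋙ G) (h₂ : t ⋙ F = t ⋙ G) : F = G :=
  congrArg Cat.Hom.toFunctor (h.hom_ext (k := F.toCatHom) (l := G.toCatHom)
    (Cat.ext h₁) (Cat.ext h₂))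

theorem exists_functor (h : IsPushout f.toCatHom g.toCatHom j.toCatHom t.toCatHom) (F : A ⥤ T)
    (G : B ⥤ T) (w : f ⋙ F = g ⋙ G) : ∃ H : D ⥤ T, j ⋙ H = F ∧ t ⋙ H = G :=
  ⟨(h.desc F.toCatHom G.toCatHom (Cat.ext w)).toFunctor,
    congrArg Cat.Hom.toFunctor (h.inl_desc F.toCatHom G.toCatHom (Cat.ext w)),
    congrArg Cat.Hom.toFunctor (h.inr_desc F.toCatHom G.toCatHom (Cat.ext w))⟩

theorem functor_comp_eq (h : IsPushout f.toCatHom g.toCatHom j.toCatHom t.toCatHom) :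
    f ⋙ j = g ⋙ t :=
  congrArg Cat.Hom.toFunctor h.w

end CategoryTheory.IsPushout

/-! ### Separated sources -/

theorem CategoryTheory.WithInitial.subsingleton_hom {A : Type u} [SmallCategory A]
    [Quiver.IsThin A] : ∀ a b : WithInitial A, Subsingleton (a ⟶ b)
  | .of a, .of b => inferInstanceAs (Subsingleton (a ⟶ b))
  | .of _, .star => inferInstanceAs (Subsingleton PEmpty)
  | .star, .of _ => inferInstanceAs (Subsingleton PUnit)
  | .star, .star => inferInstanceAs (Subsingleton PUnit)

namespace SepSource

instance (n : ℕ) : Quiver.IsThin (Pts.{u} n × AsSmall.{u} (Fin 2)) := fun _ _ =>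
  ⟨fun _ _ => Prod.ext (Subsingleton.elim _ _) (ULift.ext _ _ (Subsingleton.elim _ _))⟩

theorem hom_ext {n : ℕ} {a b : SepSource.{u} n} (f g : a ⟶ b) : f = g :=
  (WithInitial.subsingleton_hom a b).elim f g

/-- The section of the collapse functor picking the targets of the arrows. -/
def sec (n : ℕ) : Source.{u} n ⥤ SepSource.{u} n :=
  WithInitial.map (Prod.sectL (Pts.{u} n) (AsSmall.up.obj (1 : Fin 2)))

/-- The arrow from each object to the target of its edge. -/
def toTarget (n : ℕ) : 𝟭 (SepSource.{u} n) ⟶ collapse.{u} n ⋙ sec n where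
  app
    | .of a => WithInitial.incl.map (Prod.mkHom (𝟙 a.1)
        (AsSmall.up.map (homOfLE (Fin.le_last (AsSmall.down.obj a.2)))))
    | .star => 𝟙 _
  naturality _ _ _ := hom_ext _ _

theorem sec_collapse (n : ℕ) : sec.{u} n ⋙ collapse n = 𝟭 _ :=
  CategoryTheory.Functor.ext (fun a => by cases a <;> rfl)
    (fun a b _ => @Subsingleton.elim _ (WithInitial.subsingleton_hom _ _) _ _)

/-- The components of `toTarget` are the edges `x i ⟶ y i` and identities. -/
theorem toTarget_app {n : ℕ} {D : Type u} [SmallCategory D] (t : SepSource.{u} n ⥤ D)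
    (a : SepSource.{u} n) :
    (edges t).isoClosure (t.map ((toTarget n).app a)) ∨ IsIso (t.map ((toTarget n).app a)) := by
  rcases a with ⟨⟨⟨i⟩⟩, ⟨a⟩⟩ | _
  · fin_cases a
    · exact Or.inl ((edges t).le_isoClosure _ ⟨i⟩)
    · have e : (toTarget n).app (y i) = 𝟙 (y i) := hom_ext _ _
      have h : t.map ((toTarget n).app (y i)) = 𝟙 (t.obj (y i)) :=
        (congrArg (fun g => t.map g) e).trans (t.map_id _)
      have h' : IsIso (𝟙 (t.obj (y i))) := inferInstance
      rw [← h] at h'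
      exact Or.inr h'
  · exact Or.inr (inferInstanceAs (IsIso (t.map (𝟙 _))))

theorem edges_isInvertedBy {n : ℕ} {D E : Type u} [SmallCategory D] [SmallCategory E]
    {t : SepSource.{u} n ⥤ D} {k : D ⥤ E} {s : Source.{u} n ⥤ E}
    (h : t ⋙ k = collapse n ⋙ s) : (edges t).IsInvertedBy k := by
  rintro _ _ _ ⟨i⟩
  have e := Functor.congr_hom h (edge i)
  have : IsIso ((collapse n).map (edge (n := n) i)) :=
    inferInstanceAs (IsIso (𝟙 (WithInitial.of (Pts.obj i))))
  change IsIso ((t ⋙ k).map (edge i))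
  rw [e]
  dsimp only [Functor.comp_map]
  infer_instance

section Pushout

variable {n : ℕ} {C D E : Type u} [SmallCategory C] [SmallCategory D] [SmallCategory E]
  {y : Fin n → C} {j : C ⥤ D} {t : SepSource.{u} n ⥤ D} {k : D ⥤ E} {s : Source.{u} n ⥤ E}

/-- The functor `u⁻` has a section. -/
theorem exists_section
    (hD : IsPushout (Pts.functor y).toCatHom (targets.{u} n).toCatHom j.toCatHom t.toCatHom)
    (hE : IsPushout t.toCatHom (collapse.{u} n).toCatHom k.toCatHom s.toCatHom) :
    ∃ r : E ⥤ D, r ⋙ k = 𝟭 E ∧ j ⋙ k ⋙ r = j ∧ t ⋙ k ⋙ r = (collapse n ⋙ sec n) ⋙ t := by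
  have h : IsPushout (Pts.functor y).toCatHom (targets.{u} n ⋙ collapse n).toCatHom
    (j ⋙ k).toCatHom s.toCatHom := hD.paste_vert hE
  have e : targets.{u} n ⋙ collapse n ⋙ sec n = targets n := Discrete.functor_ext fun _ => rfl
  have w : Pts.functor y ⋙ j = (targets n ⋙ collapse n) ⋙ sec n ⋙ t :=
    hD.functor_comp_eq.trans (congrArg (fun F => F ⋙ t) e.symm)
  obtain ⟨r, h₁, h₂⟩ := h.exists_functor j (sec n ⋙ t) w
  have hs : t ⋙ k = collapse n ⋙ s := hE.functor_comp_eq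
  refine ⟨r, h.functor_ext ?_ ?_, h₁, ?_⟩
  · exact congrArg (fun F => F ⋙ k) h₁
  · refine (congrArg (fun F => F ⋙ k) h₂).trans ((congrArg (fun F => sec n ⋙ F) hs).trans ?_)
    exact congrArg (fun F => F ⋙ s) (sec_collapse n)
  · exact (congrArg (fun F => F ⋙ r) hs).trans (congrArg (fun F => collapse n ⋙ F) h₂)

/-- Let `F` be the endofunctor of `D⁻` that contracts the edges to their targets. The edges define a
transformation `𝟭 ⟶ F`: by the universal property of `D⁻`, it is determined by its restrictions
to `C`, where it is the identity, and to the separated source, where it is `toTarget`. -/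
theorem exists_toTarget
    (hD : IsPushout (Pts.functor y).toCatHom (targets.{u} n).toCatHom j.toCatHom t.toCatHom)
    (F : D ⥤ D) (hj : j ⋙ F = j) (ht : t ⋙ F = (collapse n ⋙ sec n) ⋙ t) :
    ∃ σ : 𝟭 D ⟶ F, ∀ a, (edges t).isoClosure (σ.app a) ∨ IsIso (σ.app a) := by
  let P : ObjectProperty (Arrow D) := fun f => (edges t).isoClosure f.hom ∨ IsIso f.hom
  -- A transformation `𝟭 ⟶ F` with components in `P` is the same as a functor to the full
  -- subcategory `P` of the category of arrows, with sources given by `𝟭` and targets by `F`.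
  let ΦC : C ⥤ P.FullSubcategory := P.lift
    { obj c := Arrow.mk (𝟙 (j.obj c))
      map g := Arrow.homMk (j.map g) (j.map g) } (fun c => Or.inr (IsIso.id (j.obj c)))
  let ΦS : SepSource.{u} n ⥤ P.FullSubcategory := P.lift
    { obj a := Arrow.mk (t.map ((toTarget n).app a))
      map {a b} g := Arrow.homMk (t.map g) (t.map ((collapse n ⋙ sec n).map g))
        ((t.map_comp _ _).symm.trans ((congrArg (fun g => t.map g)
          ((toTarget n).naturality g)).trans (t.map_comp _ _)))
      map_id a := by
        ext
        · exact t.map_id a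
        · exact (congrArg (fun g => t.map g) ((collapse n ⋙ sec n).map_id a)).trans (t.map_id _)
      map_comp f g := by
        ext
        · exact t.map_comp f g
        · exact (congrArg (fun g => t.map g) ((collapse n ⋙ sec n).map_comp f g)).trans
            (t.map_comp _ _) }
    (toTarget_app t)
  have hP (f g : P.FullSubcategory) (h : f.obj = g.obj) : f = g := by
    cases f; cases g; cases h; rfl
  have w : Pts.functor y ⋙ ΦC = targets.{u} n ⋙ ΦS := by
    refine Discrete.functor_ext ?_
    rintro ⟨i⟩
    refine hP _ _ ?_
    have e₁ : j.obj (Pts.functor y |>.obj (Pts.obj i)) = t.obj (SepSource.y i) :=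
      Functor.congr_obj hD.functor_comp_eq (Pts.obj i)
    have e₂ : (toTarget n).app (SepSource.y i) = 𝟙 (SepSource.y i) := hom_ext _ _
    change Arrow.mk (𝟙 (j.obj (Pts.functor y |>.obj (Pts.obj i)))) =
      Arrow.mk (t.map ((toTarget n).app (SepSource.y i)))
    rw [e₁]
    exact congrArg Arrow.mk ((t.map_id _).symm.trans (congrArg (fun g => t.map g) e₂.symm))
  obtain ⟨Φ, h₁, h₂⟩ := hD.exists_functor ΦC ΦS w
  have hl : Φ ⋙ P.ι ⋙ Arrow.leftFunc = 𝟭 D := hD.functor_ext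
    (congrArg (fun G => G ⋙ P.ι ⋙ Arrow.leftFunc) h₁)
    (congrArg (fun G => G ⋙ P.ι ⋙ Arrow.leftFunc) h₂)
  have hr : Φ ⋙ P.ι ⋙ Arrow.rightFunc = F := hD.functor_ext
    ((congrArg (fun G => G ⋙ P.ι ⋙ Arrow.rightFunc) h₁).trans hj.symm)
    ((congrArg (fun G => G ⋙ P.ι ⋙ Arrow.rightFunc) h₂).trans ht.symm)
  refine ⟨eqToHom hl.symm ≫ Functor.whiskerLeft (Φ ⋙ P.ι) Arrow.leftToRight ≫ eqToHom hr,
    fun a => ?_⟩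
  rcases (Φ.obj a).property with h | h
  · exact Or.inl (MorphismProperty.RespectsIso.precomp (P := (edges t).isoClosure)
      ((eqToHom hl.symm).app a) _
        (MorphismProperty.RespectsIso.postcomp (P := (edges t).isoClosure)
          ((eqToHom hr).app a) _ h))
  · have h₁ : IsIso ((eqToHom hl.symm).app a) := inferInstance
    have h₂ : IsIso ((eqToHom hr).app a) := inferInstance
    exact Or.inr (IsIso.comp_isIso' h₁ (IsIso.comp_isIso' h h₂))

/-- The functor `u⁻` and its products with small categories are homotopical localizations. -/
theorem isHomotopicalLocalization
    (hD : IsPushout (Pts.functor y).toCatHom (targets.{u} n).toCatHom j.toCatHom t.toCatHom)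
    (hE : IsPushout t.toCatHom (collapse.{u} n).toCatHom k.toCatHom s.toCatHom) :
    IsHomotopicalLocalization.{u, v, w} k (edges t) ∧ ∀ (A : Type u) [SmallCategory A],
      IsHomotopicalLocalization.{u, v, w} (k.prod (𝟭 A)) ((edges t).prodIsos A) := by
  obtain ⟨r, hr, h₁, h₂⟩ := exists_section hD hE
  obtain ⟨σ, hσ⟩ := exists_toTarget hD (k ⋙ r) h₁ h₂
  have hk : (edges t).isoClosure.IsInvertedBy k :=
    (MorphismProperty.IsInvertedBy.isoClosure_iff (edges t) k).2
      (edges_isInvertedBy hE.functor_comp_eq)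
  refine ⟨.of_le_isoClosure (.of_section hk r (eqToIso hr) σ hσ) le_rfl, fun A _ => ?_⟩
  refine .of_le_isoClosure (.of_section (MorphismProperty.prodIsos_isInvertedBy hk A)
    (r.prod (𝟭 A)) (NatIso.prod (eqToIso hr) (Iso.refl (𝟭 A))) (NatTrans.prod σ (𝟙 (𝟭 A)))
    ?_) ((edges t).prodIsos_isoClosure_le A)
  rintro ⟨d, a⟩
  rcases hσ d with h | h
  · exact Or.inl ⟨h, IsIso.id a⟩
  · refine Or.inr ?_
    rw [isIso_prod_iff]
    exact ⟨h, IsIso.id a⟩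

end Pushout

end SepSource

/-! ### Separated sinks -/

namespace SepSink

variable {n : ℕ} {C D E : Type u} [SmallCategory C] [SmallCategory D] [SmallCategory E]

theorem edges_isInvertedBy {t : SepSink.{u} n ⥤ D} {k : D ⥤ E} {s : Sink.{u} n ⥤ E}
    (h : t ⋙ k = collapse n ⋙ s) : (edges t).IsInvertedBy k := by
  rintro _ _ _ ⟨i⟩
  have e := Functor.congr_hom h (edge i)
  have h' : IsIso ((collapse.{u} n).map (edge.{u} i)) := by
    have h : (collapse.{u} n).map (edge.{u} i) = 𝟙 (WithTerminal.incl.obj (Pts.obj i)) :=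
      Category.id_comp _
    rw [h]
    exact IsIso.id _
  change IsIso ((t ⋙ k).map (edge i))
  rw [e]
  dsimp only [Functor.comp_map]
  infer_instance

theorem edges_map {t : SepSink.{u} n ⥤ D} {k : D ⥤ E} {t' : SepSink.{u} n ⥤ E} (h : t ⋙ k = t')
    ⦃a b : D⦄ (g : a ⟶ b) (hg : edges t g) : (edges t').isoClosure (k.map g) := by
  subst h
  obtain ⟨i⟩ := hg
  exact (edges (t ⋙ k)).le_isoClosure _ ⟨i⟩

/-- The functor `u⁺` and its products with small categories are homotopical localizations. This
follows from the case of the explicit models, as pushouts are unique up to isomorphism. -/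
theorem isHomotopicalLocalization {y : Fin n → C} {j : C ⥤ D} {t : SepSink.{u} n ⥤ D}
    {k : D ⥤ E} {s : Sink.{u} n ⥤ E}
    (hD : IsPushout (Pts.functor y).toCatHom (targets.{u} n).toCatHom j.toCatHom t.toCatHom)
    (hE : IsPushout t.toCatHom (collapse.{u} n).toCatHom k.toCatHom s.toCatHom) :
    IsHomotopicalLocalization.{u, v, w} k (edges t) ∧ ∀ (A : Type u) [SmallCategory A],
      IsHomotopicalLocalization.{u, v, w} (k.prod (𝟭 A)) ((edges t).prodIsos A) := by
  have hE' : IsPushout (Pts.functor y).toCatHom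
      ((targets.{u} n).toCatHom ≫ (collapse.{u} n).toCatHom) (j ⋙ k).toCatHom s.toCatHom :=
    hD.paste_vert hE
  let iD := hD.isoIsPushout _ _ (Separated.isPushout y)
  let iE := hE'.isoIsPushout _ _ (Attached.isPushout y)
  have hj : j ⋙ iD.hom.toFunctor = Separated.incl y := congrArg Cat.Hom.toFunctor
    (hD.inl_isoIsPushout_hom _ _ (Separated.isPushout y))
  have ht : t ⋙ iD.hom.toFunctor = Separated.sink y := congrArg Cat.Hom.toFunctor
    (hD.inr_isoIsPushout_hom _ _ (Separated.isPushout y))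
  have ht' : Separated.sink y ⋙ iD.inv.toFunctor = t := congrArg Cat.Hom.toFunctor
    (hD.inr_isoIsPushout_inv _ _ (Separated.isPushout y))
  have hj' : (j ⋙ k) ⋙ iE.hom.toFunctor = Attached.incl y := congrArg Cat.Hom.toFunctor
    (hE'.inl_isoIsPushout_hom _ _ (Attached.isPushout y))
  have hs : s ⋙ iE.hom.toFunctor = Attached.sink y := congrArg Cat.Hom.toFunctor
    (hE'.inr_isoIsPushout_hom _ _ (Attached.isPushout y))
  have hk : k ⋙ iE.hom.toFunctor = iD.hom.toFunctor ⋙ Separated.contract y := by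
    refine hD.functor_ext ?_ ?_
    · exact hj'.trans (congrArg (fun F => F ⋙ Separated.contract y) hj.symm)
    · refine (congrArg (fun F => F ⋙ iE.hom.toFunctor) hE.functor_comp_eq).trans ?_
      refine (congrArg (fun F => collapse.{u} n ⋙ F) hs).trans ?_
      exact Separated.sink_contract.symm.trans
        (congrArg (fun F => F ⋙ Separated.contract y) ht.symm)
  let eD : D ≌ Separated y := Cat.equivOfIso iD
  let eE : E ≌ Attached y := Cat.equivOfIso iE
  refine ⟨Separated.isHomotopicalLocalization_contract.of_equivalence eD eE (eqToIso hk)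
    (edges_map ht'), fun A _ => ?_⟩
  refine (Separated.isHomotopicalLocalization_contract_prod A).of_equivalence
    (eD.prod .refl) (eE.prod .refl)
    (NatIso.prod (eqToIso hk) (Iso.refl (𝟭 A))) ?_
  rintro ⟨x, a⟩ ⟨x', a'⟩ ⟨g, f⟩ ⟨hg, hf⟩
  exact (edges t).prodIsos_isoClosure_le A _ ⟨edges_map ht' g hg, hf⟩

end SepSink

/-! ### Consequences of being a homotopical localization -/

namespace IsHomotopicalLocalization

variable {E F : Type u} [SmallCategory E] [SmallCategory F] {k : E ⥤ F} {W : MorphismProperty E}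

theorem isHomotopicalEpi (h : IsHomotopicalLocalization.{u, v, w} k W) :
    IsHomotopicalEpi.{u, v, w} k :=
  fun D hD => ⟨h.full D hD, h.faithful D hD⟩

theorem invertedProp_of_iso {D : PDer.{u, v, w}} {A : (Cat.{u, u})ᵒᵖ}
    {X Y : D.obj ((prodLeft E).obj A)} (e : X ≅ Y) (hX : (invertedProp D W).prop A X) :
    (invertedProp D W).prop A Y := by
  intro x y f hf
  have := hX f hf
  exact (NatTrans.isIso_app_iff_of_iso (D.map₂ (sectMap f A)).toNatTrans e).1 this

/-- The essential image of restriction along a functor that is a homotopical localization after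
multiplication with `A`. -/
theorem essImage_res (hW : W.IsInvertedBy k) {A : Type u} [SmallCategory A]
    (h : IsHomotopicalLocalization.{u, v, w} (k.prod (𝟭 A)) (W.prodIsos A))
    {D : PDer.{u, v, w}} (hD : D.IsDerivator) :
    (D.res (k.prod (𝟭 A))).essImage = (invertedProp D W).prop (op (Cat.of A)) := by
  funext X
  refine propext ⟨?_, fun hX => h.essImage D hD X (PDer.invertedProp.inverts hX)⟩
  rintro ⟨Y, ⟨e⟩⟩
  exact invertedProp_of_iso e (invertedProp_restrict k W hW D (op (Cat.of A)) Y)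

theorem isEquivalence_restrictInverted (hW : W.IsInvertedBy k)
    (h : ∀ (A : Type u) [SmallCategory A],
      IsHomotopicalLocalization.{u, v, w} (k.prod (𝟭 A)) (W.prodIsos A))
    {D : PDer.{u, v, w}} (hD : D.IsDerivator) (A : (Cat.{u, u})ᵒᵖ) :
    (((restrictInverted k W hW).app D).app A).toFunctor.IsEquivalence := by
  let P := (invertedProp D W).prop A
  let R : D.Diag (F × A.unop) ⥤ D.Diag (E × A.unop) := D.res (k.prod (𝟭 A.unop))
  have h₁ : R.Full := (h A.unop).full D hD
  have h₂ : R.Faithful := (h A.unop).faithful D hD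
  have hR : ∀ Y, P (R.obj Y) := invertedProp_restrict k W hW D A
  have h₃ : (P.lift R hR).EssSurj := ⟨fun X => by
    obtain ⟨Y, ⟨e⟩⟩ := (h A.unop).essImage D hD X.obj (PDer.invertedProp.inverts X.property)
    exact ⟨Y, ⟨P.isoMk e⟩⟩⟩
  have h₄ : (P.lift R hR).Full := inferInstance
  have h₅ : (P.lift R hR).Faithful := inferInstance
  have h₆ : (P.lift R hR).IsEquivalence := { }
  exact h₆

/-- For a derivator `D`, restriction `D^F ⟶ D^{E,W}` is an equivalence. -/
theorem exists_equivalence (hW : W.IsInvertedBy k)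
    (h : ∀ (A : Type u) [SmallCategory A],
      IsHomotopicalLocalization.{u, v, w} (k.prod (𝟭 A)) (W.prodIsos A))
    {D : PDer.{u, v, w}} (hD : D.IsDerivator) :
    ∃ e : Bicategory.Equivalence ((shiftFunctor F).obj D) ((invertedShiftFunctor W).obj D),
      e.hom = (restrictInverted k W hW).app D :=
  have := isEquivalence_restrictInverted hW h hD
  ⟨PseudoEquiv.equivalence ((restrictInverted k W hW).app D), rfl⟩

end IsHomotopicalLocalization

theorem mainTheorem6 (n : ℕ) (C : Cat.{u, u}) (y : Fin n → C)
    (Dm Cm : Cat.{u, u}) (jm : C ⟶ Dm) (tm : Cat.of (SepSource.{u} n) ⟶ Dm)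
    (um : Dm ⟶ Cm) (sm : Cat.of (Source.{u} n) ⟶ Cm)
    (hDm : IsPushout (Pts.functor y).toCatHom (SepSource.targets.{u} n).toCatHom jm tm)
    (hCm : IsPushout tm (SepSource.collapse.{u} n).toCatHom um sm)
    (Dp Cp : Cat.{u, u}) (jp : C ⟶ Dp) (tp : Cat.of (SepSink.{u} n) ⟶ Dp)
    (up : Dp ⟶ Cp) (sp : Cat.of (Sink.{u} n) ⟶ Cp)
    (hDp : IsPushout (Pts.functor y).toCatHom (SepSink.targets.{u} n).toCatHom jp tp)
    (hCp : IsPushout tp (SepSink.collapse.{u} n).toCatHom up sp) :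
    (IsHomotopicalEpi.{u, v, w} up.toFunctor ∧
      (∀ D : PDer.{u, v, w}, D.IsDerivator → ∀ (A : Type u) [SmallCategory A],
        (D.res (up.toFunctor.prod (𝟭 A))).essImage =
          (invertedProp D (SepSink.edges tp.toFunctor)).prop (op (Cat.of A))) ∧
      ∃ h : (SepSink.edges tp.toFunctor).IsInvertedBy up.toFunctor, ∀ D : PDer.{u, v, w}, D.IsDerivator →
        ∃ e : Bicategory.Equivalence ((shiftFunctor Cp).obj D)
            ((invertedShiftFunctor (SepSink.edges tp.toFunctor)).obj D),
          e.hom = (restrictInverted up.toFunctor (SepSink.edges tp.toFunctor) h).app D) ∧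
    (IsHomotopicalEpi.{u, v, w} um.toFunctor ∧
      (∀ D : PDer.{u, v, w}, D.IsDerivator → ∀ (A : Type u) [SmallCategory A],
        (D.res (um.toFunctor.prod (𝟭 A))).essImage =
          (invertedProp D (SepSource.edges tm.toFunctor)).prop (op (Cat.of A))) ∧
      ∃ h : (SepSource.edges tm.toFunctor).IsInvertedBy um.toFunctor, ∀ D : PDer.{u, v, w}, D.IsDerivator →
        ∃ e : Bicategory.Equivalence ((shiftFunctor Cm).obj D)
            ((invertedShiftFunctor (SepSource.edges tm.toFunctor)).obj D),
          e.hom = (restrictInverted um.toFunctor (SepSource.edges tm.toFunctor) h).app D) := by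
  have hp := SepSink.isHomotopicalLocalization (C := C) (D := Dp) (E := Cp) (j := jp.toFunctor)
    (t := tp.toFunctor) (k := up.toFunctor) (s := sp.toFunctor) hDp hCp
  have hm := SepSource.isHomotopicalLocalization (C := C) (D := Dm) (E := Cm) (j := jm.toFunctor)
    (t := tm.toFunctor) (k := um.toFunctor) (s := sm.toFunctor) hDm hCm
  have wp : (SepSink.edges tp.toFunctor).IsInvertedBy up.toFunctor :=
    SepSink.edges_isInvertedBy (congrArg Cat.Hom.toFunctor hCp.w)
  have wm : (SepSource.edges tm.toFunctor).IsInvertedBy um.toFunctor :=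
    SepSource.edges_isInvertedBy (congrArg Cat.Hom.toFunctor hCm.w)
  exact ⟨⟨hp.1.isHomotopicalEpi, fun D hD A _ => (hp.2 A).essImage_res wp hD,
      wp, fun D hD => IsHomotopicalLocalization.exists_equivalence wp hp.2 hD⟩,
    ⟨hm.1.isHomotopicalEpi, fun D hD A _ => (hm.2 A).essImage_res wm hD,
      wm, fun D hD => IsHomotopicalLocalization.exists_equivalence wm hm.2 hD⟩⟩
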